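/- Let $\mathbb{F}$ be a field of characteristic $0$. The tetrahedron algebra $\boxtimes$ is the Lie algebra over $\mathbb{F}$ with generators $x_{ij}$ ($i,j\in\{0,1,2,3\}$, $i\neq j$) and relations (i) $x_{ij}+x_{ji}=0$ for distinct $i,j$; (ii) $[x_{hi},x_{ij}]=2x_{hi}+2x_{ij}$ for mutually distinct $h,i,j$; (iii) $[x_{hi},[x_{hi},[x_{hi},x_{jk}]]]=4[x_{hi},x_{jk}]$ for mutually distinct $h,i,j,k$. For distinct $i,j$ let $X_{ij}$ be the subspace of all $\xi\in\boxtimes$ such that $[x_{ij},\xi]=0$ and $[x_{hk},[x_{hk},[x_{hk},\xi]]]=4[x_{hk},\xi]$ whenever $h,i,j,k$ are mutually distinct. Let $\mathcal{O}$, $\mathcal{O}'$, $\mathcal{O}''$ be the Lie subalgebras of $\boxtimes$ generated by $\{x_{12},x_{03}\}$, $\{x_{23},x_{01}\}$, $\{x_{31},x_{02}\}$ respectively. **Proposition.** The following sums of subspaces are direct: \begin{align*} \mathcal{O}&=(X_{12}\cap\mathcal{O})+(X_{23}\cap\mathcal{O})+(X_{31}\cap\mathcal{O}),\\ \mathcal{O}'&=(X_{23}\cap\mathcal{O}')+(X_{31}\cap\mathcal{O}')+(X_{12}\cap\mathcal{O}'),\\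 \mathcal{O}''&=(X_{31}\cap\mathcal{O}'')+(X_{12}\cap\mathcal{O}'')+(X_{23}\cap\mathcal{O}''), \end{align*} and \begin{align*} X_{12}&=(X_{12}\cap\mathcal{O})+(X_{12}\cap\mathcal{O}')+(X_{12}\cap\mathcal{O}''),\\ X_{23}&=(X_{23}\cap\mathcal{O})+(X_{23}\cap\mathcal{O}')+(X_{23}\cap\mathcal{O}''),\\ X_{31}&=(X_{31}\cap\mathcal{O})+(X_{31}\cap\mathcal{O}')+(X_{31}\cap\mathcal{O}''). \end{align*} Moreover, the sum of the nine subspaces $X\cap O$, with $X\in\{X_{12},X_{23},X_{31}\}$ and $O\in\{\mathcal{O},\mathcal{O}',\mathcal{O}''\}$ (indexed by the nine pairs), is direct and equal to $\boxtimes$. -/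

import Mathlib

noncomputable section

namespace TetrahedronAlgebra

/-- The index set of the twelve standard generators: ordered pairs of distinct elements of
`{0, 1, 2, 3}`. -/
abbrev Gen : Type := {p : Fin 4 × Fin 4 // p.1 ≠ p.2}

/-- The letter `x_{ij}` (for `i ≠ j`) in the free Lie algebra on the generators. -/
def freeGen (F : Type*) [Field F] (i j : Fin 4) (hij : i ≠ j) : FreeLieAlgebra F Gen :=
  FreeLieAlgebra.of F ⟨(i, j), hij⟩

/-- The relators of the tetrahedron algebra. -/
inductive Relator (F : Type*) [Field F] : FreeLieAlgebra F Gen → Prop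
  /-- `x_{ij} + x_{ji} = 0`. -/
  | skew (i j : Fin 4) (hij : i ≠ j) :
      Relator F (freeGen F i j hij + freeGen F j i hij.symm)
  /-- `[x_{hi}, x_{ij}] = 2 x_{hi} + 2 x_{ij}` for mutually distinct `h, i, j`. -/
  | triangle (h i j : Fin 4) (hhi : h ≠ i) (hij : i ≠ j) (hhj : h ≠ j) :
      Relator F (⁅freeGen F h i hhi, freeGen F i j hij⁆
        - ((2 : F) • freeGen F h i hhi + (2 : F) • freeGen F i j hij))
  /-- `[x_{hi}, [x_{hi}, [x_{hi}, x_{jk}]]] = 4 [x_{hi}, x_{jk}]` for mutually distinct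
  `h, i, j, k`. -/
  | dolanGrady (h i j k : Fin 4) (hhi : h ≠ i) (hhj : h ≠ j) (hhk : h ≠ k)
      (hij : i ≠ j) (hik : i ≠ k) (hjk : j ≠ k) :
      Relator F
        (⁅freeGen F h i hhi, ⁅freeGen F h i hhi, ⁅freeGen F h i hhi, freeGen F j k hjk⁆⁆⁆
          - (4 : F) • ⁅freeGen F h i hhi, freeGen F j k hjk⁆)

/-- The ideal of the free Lie algebra generated by the relators. -/
def relatorIdeal (F : Type*) [Field F] : LieIdeal F (FreeLieAlgebra F Gen) :=
  LieSubmodule.lieSpan F (FreeLieAlgebra F Gen) {r | Relator F r}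

/-- The tetrahedron algebra over `F`. -/
abbrev Tet (F : Type*) [Field F] : Type _ := FreeLieAlgebra F Gen ⧸ relatorIdeal F

/-- The standard generator `x_{ij}` of the tetrahedron algebra. -/
def x (F : Type*) [Field F] (i j : Fin 4) (hij : i ≠ j := by decide) : Tet F :=
  LieSubmodule.Quotient.mk (freeGen F i j hij)

/-- The subspace `X_{ij}` of all `x_{ij}`-like elements: those `ξ` that commute with `x_{ij}` and
satisfy the Dolan-Grady relation `[x_{hk}, [x_{hk}, [x_{hk}, ξ]]] = 4 [x_{hk}, ξ]` whenever
`h, i, j, k` are mutually distinct. -/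
def X (F : Type*) [Field F] (i j : Fin 4) (hij : i ≠ j := by decide) : Submodule F (Tet F) where
  carrier := {ξ | ⁅x F i j hij, ξ⁆ = 0 ∧
    ∀ (h k : Fin 4) (hhk : h ≠ k), h ≠ i → h ≠ j → k ≠ i → k ≠ j →
      ⁅x F h k hhk, ⁅x F h k hhk, ⁅x F h k hhk, ξ⁆⁆⁆ = (4 : F) • ⁅x F h k hhk, ξ⁆}
  zero_mem' := by simp
  add_mem' := by
    rintro a b ⟨ha, ha'⟩ ⟨hb, hb'⟩
    refine ⟨by rw [lie_add, ha, hb, add_zero], fun h k hhk h1 h2 h3 h4 => ?_⟩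
    simp only [lie_add, smul_add]
    rw [ha' h k hhk h1 h2 h3 h4, hb' h k hhk h1 h2 h3 h4]
  smul_mem' := by
    rintro c a ⟨ha, ha'⟩
    refine ⟨by rw [lie_smul, ha, smul_zero], fun h k hhk h1 h2 h3 h4 => ?_⟩
    simp only [lie_smul]
    rw [ha' h k hhk h1 h2 h3 h4, smul_comm]

/-- The Lie subalgebra generated by `x_{hi}` and `x_{jk}`. -/
def onsager (F : Type*) [Field F] (h i j k : Fin 4) (hhi : h ≠ i := by decide)
    (hjk : j ≠ k := by decide) : LieSubalgebra F (Tet F) :=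
  LieSubalgebra.lieSpan F (Tet F) {x F h i hhi, x F j k hjk}

/-- The subspaces `X_{12}, X_{23}, X_{31}`. -/
def row (F : Type*) [Field F] : Fin 3 → Submodule F (Tet F) :=
  ![X F 1 2, X F 2 3, X F 3 1]

/-- The underlying subspaces of the Onsager subalgebras `O = ⟨x_{12}, x_{03}⟩`,
`O' = ⟨x_{23}, x_{01}⟩`, `O'' = ⟨x_{31}, x_{02}⟩`. -/
def col (F : Type*) [Field F] : Fin 3 → Submodule F (Tet F) :=
  ![(onsager F 1 2 0 3).toSubmodule, (onsager F 2 3 0 1).toSubmodule,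
    (onsager F 3 1 0 2).toSubmodule]

/-- The sum of the family `A` of subspaces is direct and equal to the subspace `W`. -/
def IsDirectSumOf {F V ι : Type*} [Field F] [AddCommGroup V] [Module F V]
    (W : Submodule F V) (A : ι → Submodule F V) : Prop :=
  iSupIndep A ∧ ⨆ i, A i = W

end TetrahedronAlgebra

end

/-! The tetrahedron algebra behaves as sl₂ ⊗ A with A = F[t, t⁻¹, (1 - t)⁻¹], where x₁₂, x₂₃, x₃₁
form the equitable basis `b 0`, `b 1`, `b 2` of sl₂. Put t₀ = t, t₁ = 1 - t⁻¹, t₂ = (1 - t)⁻¹, with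
indices mod 3. The substitution t ↦ 1 - t⁻¹ permutes these cyclically, and t_c t_{c+1} = t_c - 1.
Partial fractions with poles at ∞, 0, 1 give A = F[t_r] ⊕ (t_{r+1} - 1)F[t_{r+1}] ⊕
t_{r+2}F[t_{r+2}] for each r. Applied to the coefficient of each `b r`, this gives nine summands
indexed by (r, c). The r-th X consists of the summands with first index r, the c-th Onsager
subalgebra of those with second index c, so every claim becomes a statement about disjoint sets of
indices.

The algebra A is never built inside the presented algebra. An element f of A is replaced by the
linear map p ↦ p ⊗ f out of sl₂, and `Mul φ ψ χ` expresses that χ is the product of φ and ψ. The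
relations provide a map for each t_c (`TetRel.exists_equivariant`). The Dolan-Grady relations make
its powers multiply correctly (`mul_power`), and the remaining relations give t_c t_{c+1} = t_c - 1
(`TetRel.mul_succ`).

Spanning (`total_surjective`) holds because the span of these maps is stable under bracketing with
the generators. Independence (`total_injective`) follows from the evaluation homomorphisms to sl₂ at
all t ≠ 0, 1, together with `partial_fractions_eq_zero`. In the resulting coordinates,
`row_eq_supported` and `col_eq_supported` identify the rows and columns. -/

noncomputable section

/-- A three-dimensional space carrying the Lie bracket of `sl₂` in its equitable basis. -/
def Equit (F : Type*) : Type _ := Fin 3 → F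

/-! ### The Lie algebra sl₂ in its equitable basis. -/

namespace Equit

@[ext] theorem ext {F : Type*} {p q : Equit F} (h : ∀ i, p i = q i) : p = q := funext h

theorem ext_three {F : Type*} {p q : Equit F} (h0 : p 0 = q 0) (h1 : p 1 = q 1)
    (h2 : p 2 = q 2) : p = q := by
  ext i; fin_cases i <;> assumption

section Basic

variable {F : Type*} [Field F]

instance : AddCommGroup (Equit F) := inferInstanceAs (AddCommGroup (Fin 3 → F))

instance : Module F (Equit F) := inferInstanceAs (Module F (Fin 3 → F))

instance : Bracket (Equit F) (Equit F) where
  bracket p q := ![2 * (p 0 * q 1 - p 1 * q 0) + 2 * (p 2 * q 0 - p 0 * q 2),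
    2 * (p 0 * q 1 - p 1 * q 0) + 2 * (p 1 * q 2 - p 2 * q 1),
    2 * (p 1 * q 2 - p 2 * q 1) + 2 * (p 2 * q 0 - p 0 * q 2)]

@[simp] theorem add_apply (p q : Equit F) (i : Fin 3) : (p + q) i = p i + q i := rfl
@[simp] theorem sub_apply (p q : Equit F) (i : Fin 3) : (p - q) i = p i - q i := rfl
@[simp] theorem neg_apply (p : Equit F) (i : Fin 3) : (-p) i = -p i := rfl
@[simp] theorem zero_apply (i : Fin 3) : (0 : Equit F) i = 0 := rfl
@[simp] theorem smul_apply (a : F) (p : Equit F) (i : Fin 3) : (a • p) i = a * p i := rfl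

@[simp] theorem bracket_zero (p q : Equit F) :
    ⁅p, q⁆ 0 = 2 * (p 0 * q 1 - p 1 * q 0) + 2 * (p 2 * q 0 - p 0 * q 2) := rfl
@[simp] theorem bracket_one (p q : Equit F) :
    ⁅p, q⁆ 1 = 2 * (p 0 * q 1 - p 1 * q 0) + 2 * (p 1 * q 2 - p 2 * q 1) := rfl
@[simp] theorem bracket_two (p q : Equit F) :
    ⁅p, q⁆ 2 = 2 * (p 1 * q 2 - p 2 * q 1) + 2 * (p 2 * q 0 - p 0 * q 2) := rfl

instance : LieRing (Equit F) where
  add_lie p q r := by apply ext_three <;> simp <;> ring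
  lie_add p q r := by apply ext_three <;> simp <;> ring
  lie_self p := by apply ext_three <;> simp <;> ring
  leibniz_lie p q r := by apply ext_three <;> simp <;> ring

instance : LieAlgebra F (Equit F) where
  lie_smul a p q := by apply ext_three <;> simp <;> ring

/-- The equitable basis. -/
def b (i : Fin 3) : Equit F := Pi.single i (1 : F)

theorem b_apply (i j : Fin 3) : (b i : Equit F) j = if j = i then 1 else 0 := by
  simp [b, Pi.single_apply]

theorem eq_sum_b (p : Equit F) : p = ∑ i, p i • b i := by
  rw [Fin.sum_univ_three]
  apply ext_three <;> simp [b_apply]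

theorem eq_combination_b (i : Fin 3) (p : Equit F) :
    p = p i • b i + p (i + 1) • b (i + 1) + p (i + 2) • b (i + 2) := by
  fin_cases i <;> apply ext_three <;> simp [b_apply]

/-- The invariant symmetric bilinear form, normalised by `⟨b i, b i⟩ = 1`. -/
def form (p q : Equit F) : F :=
  p 0 * q 0 + p 1 * q 1 + p 2 * q 2 - (p 0 * q 1 + p 1 * q 0) - (p 1 * q 2 + p 2 * q 1)
    - (p 2 * q 0 + p 0 * q 2)

theorem form_symm (p q : Equit F) : form p q = form q p := by
  simp only [form]; ring

theorem form_smul_right (a : F) (p q : Equit F) : form p (a • q) = a * form p q := by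
  simp only [form, smul_apply]; ring

/-- The nilpotent element `b i + b (i + 1)`, of weight `2` for `b i`. -/
def up (i : Fin 3) : Equit F := b i + b (i + 1)

/-- The nilpotent element `b i + b (i + 2)`, of weight `-2` for `b i`. -/
def down (i : Fin 3) : Equit F := b i + b (i + 2)

theorem lie_b_succ (i : Fin 3) :
    ⁅(b i : Equit F), b (i + 1)⁆ = (2 : F) • (b i + b (i + 1) : Equit F) := by
  fin_cases i <;> apply ext_three <;> simp [b_apply]

theorem lie_b_up (i : Fin 3) : ⁅(b i : Equit F), up i⁆ = (2 : F) • (up i : Equit F) := by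
  fin_cases i <;> apply ext_three <;> simp [b_apply, up]

theorem lie_b_down (i : Fin 3) : ⁅(b i : Equit F), down i⁆ = (-2 : F) • (down i : Equit F) := by
  fin_cases i <;> apply ext_three <;> simp [b_apply, down]

theorem lie_up_down (i : Fin 3) : ⁅(up i : Equit F), down i⁆ = (-4 : F) • (b i : Equit F) := by
  fin_cases i <;> apply ext_three <;> simp [b_apply, down, up] <;> norm_num

theorem lie_up_b (i : Fin 3) : ⁅(up i : Equit F), b i⁆ = (-2 : F) • (up i : Equit F) := by
  rw [← lie_skew, lie_b_up]; module

theorem lie_down_b (i : Fin 3) : ⁅(down i : Equit F), b i⁆ = (2 : F) • (down i : Equit F) := by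
  rw [← lie_skew, lie_b_down]; module

theorem lie_down_up (i : Fin 3) : ⁅(down i : Equit F), up i⁆ = (4 : F) • (b i : Equit F) := by
  rw [← lie_skew, lie_up_down]; module

theorem form_b_b (i : Fin 3) : form (b i : Equit F) (b i) = 1 := by
  fin_cases i <;> simp [form, b_apply]
theorem form_b_up (i : Fin 3) : form (b i : Equit F) (up i) = 0 := by
  fin_cases i <;> simp [form, b_apply, up]
theorem form_b_down (i : Fin 3) : form (b i : Equit F) (down i) = 0 := by
  fin_cases i <;> simp [form, b_apply, down]
theorem form_up_up (i : Fin 3) : form (up i : Equit F) (up i) = 0 := by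
  fin_cases i <;> simp [form, b_apply, up]
theorem form_down_down (i : Fin 3) : form (down i : Equit F) (down i) = 0 := by
  fin_cases i <;> simp [form, b_apply, down]
theorem form_up_down (i : Fin 3) : form (up i : Equit F) (down i) = -2 := by
  fin_cases i <;> simp [form, b_apply, up, down] <;> ring
theorem form_up_b (i : Fin 3) : form (up i : Equit F) (b i) = 0 := by
  rw [form_symm, form_b_up]
theorem form_down_b (i : Fin 3) : form (down i : Equit F) (b i) = 0 := by
  rw [form_symm, form_b_down]
theorem form_down_up (i : Fin 3) : form (down i : Equit F) (up i) = -2 := by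
  rw [form_symm, form_up_down]

theorem eq_combination (i : Fin 3) (p : Equit F) :
    p = (p i - p (i + 1) - p (i + 2)) • b i + p (i + 1) • up i + p (i + 2) • down i := by
  conv_lhs => rw [eq_combination_b i p]
  simp only [up, down]; module

/-- The form as a bilinear map. -/
def formBilin : Equit F →ₗ[F] Equit F →ₗ[F] F :=
  LinearMap.mk₂ F form (fun _ _ _ => by simp only [form, add_apply]; ring)
    (fun _ _ _ => by simp only [form, smul_apply, smul_eq_mul]; ring)
    (fun _ _ _ => by simp only [form, add_apply]; ring)
    (fun _ _ _ => by simp only [form, smul_apply, smul_eq_mul]; ring)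

end Basic

section Maps

variable {F L : Type*} [Field F] [AddCommGroup L] [Module F L]

/-- The linear map sending the equitable basis to a given family. -/
def lift (s : Fin 3 → L) : Equit F →ₗ[F] L := Fintype.linearCombination F s

@[simp] theorem lift_b (s : Fin 3 → L) (i : Fin 3) : lift s (b i : Equit F) = s i := by
  change Fintype.linearCombination F s (Pi.single i (1 : F)) = s i
  simp

theorem hom_ext {φ ψ : Equit F →ₗ[F] L} (h : ∀ i, φ (b i) = ψ (b i)) : φ = ψ := by
  ext p
  rw [eq_sum_b p]
  simp [h]

theorem exists_hom_weight (i : Fin 3) (u v w : L) :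
    ∃ φ : Equit F →ₗ[F] L, φ (b i) = u ∧ φ (up i) = v ∧ φ (down i) = w := by
  refine ⟨lift (fun j => if j = i then u else if j = i + 1 then v - u else w - u), ?_⟩
  have h1 : i + 1 ≠ i := by revert i; decide
  have h2 : i + 2 ≠ i := by revert i; decide
  have h3 : i + 2 ≠ i + 1 := by revert i; decide
  simp [up, down, h1, h2, h3]

theorem bilin_ext (i : Fin 3) {S T : Equit F →ₗ[F] Equit F →ₗ[F] L}
    (hbb : S (b i) (b i) = T (b i) (b i)) (hbu : S (b i) (up i) = T (b i) (up i))
    (hbd : S (b i) (down i) = T (b i) (down i)) (hub : S (up i) (b i) = T (up i) (b i))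
    (huu : S (up i) (up i) = T (up i) (up i)) (hud : S (up i) (down i) = T (up i) (down i))
    (hdb : S (down i) (b i) = T (down i) (b i)) (hdu : S (down i) (up i) = T (down i) (up i))
    (hdd : S (down i) (down i) = T (down i) (down i)) (p q : Equit F) : S p q = T p q := by
  rw [eq_combination i p, eq_combination i q]
  simp only [map_add, map_smul, LinearMap.add_apply, LinearMap.smul_apply, hbb, hbu, hbd, hub,
    huu, hud, hdb, hdu, hdd]

end Maps

end Equit

/-! ### Products of maps out of sl₂, and equivariant bilinear maps. -/

namespace Equit

variable {F L : Type*} [Field F] [LieRing L] [LieAlgebra F L]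

/-- `Mul φ ψ χ` says that `χ` is the product of the maps `φ` and `ψ`, in the sense of the
coordinate algebra: `⁅φ p, ψ q⁆ = χ ⁅p, q⁆`. For a Lie algebra map `ι`, `Mul ι φ φ` says that `φ` is
equivariant. -/
def Mul (φ ψ χ : Equit F →ₗ[F] L) : Prop := ∀ p q, ⁅φ p, ψ q⁆ = χ ⁅p, q⁆

/-- The product of `φ` and `ψ` is `χ` up to an invariant scalar part with coefficient `c`. -/
def MulForm (φ ψ χ : Equit F →ₗ[F] L) (c : L) : Prop :=
  ∀ p q, ⁅φ p, ψ q⁆ = χ ⁅p, q⁆ + form p q • c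

/-- The bracket of the values of two maps, as a bilinear map. -/
def lieBilin (φ ψ : Equit F →ₗ[F] L) : Equit F →ₗ[F] Equit F →ₗ[F] L :=
  LinearMap.mk₂ F (fun p q => ⁅φ p, ψ q⁆) (by simp) (by simp) (by simp) (by simp)

@[simp] theorem lieBilin_apply (φ ψ : Equit F →ₗ[F] L) (p q : Equit F) :
    lieBilin φ ψ p q = ⁅φ p, ψ q⁆ := rfl

/-- A linear map applied to the bracket, as a bilinear map. -/
def mapLie (χ : Equit F →ₗ[F] L) : Equit F →ₗ[F] Equit F →ₗ[F] L :=
  LinearMap.mk₂ F (fun p q => χ ⁅p, q⁆) (by simp) (by simp) (by simp) (by simp)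

@[simp] theorem mapLie_apply (χ : Equit F →ₗ[F] L) (p q : Equit F) :
    mapLie χ p q = χ ⁅p, q⁆ := rfl

/-- The form times a vector, as a bilinear map. -/
def formSmul (c : L) : Equit F →ₗ[F] Equit F →ₗ[F] L :=
  formBilin.compr₂ (LinearMap.toSpanSingleton F L c)

@[simp] theorem formSmul_apply (c : L) (p q : Equit F) :
    formSmul c p q = form p q • c := rfl

theorem mulForm_zero {φ ψ χ : Equit F →ₗ[F] L} : MulForm φ ψ χ 0 ↔ Mul φ ψ χ := by
  simp [MulForm, Mul]

theorem Mul.symm {φ ψ χ : Equit F →ₗ[F] L} (h : Mul φ ψ χ) : Mul ψ φ χ := fun p q => by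
  rw [← lie_skew, h, ← lie_skew q p, map_neg, neg_neg]

theorem Mul.add_right {φ ψ ψ' χ χ' : Equit F →ₗ[F] L} (h : Mul φ ψ χ) (h' : Mul φ ψ' χ') :
    Mul φ (ψ + ψ') (χ + χ') := fun p q => by simp [h p q, h' p q]

theorem Mul.sub_right {φ ψ ψ' χ χ' : Equit F →ₗ[F] L} (h : Mul φ ψ χ) (h' : Mul φ ψ' χ') :
    Mul φ (ψ - ψ') (χ - χ') := fun p q => by simp [h p q, h' p q]

theorem Mul.smul_right {φ ψ χ : Equit F →ₗ[F] L} (a : F) (h : Mul φ ψ χ) :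
    Mul φ (a • ψ) (a • χ) := fun p q => by simp [h p q]

theorem Mul.zero_right (φ : Equit F →ₗ[F] L) : Mul φ 0 0 := fun p q => by simp

theorem Mul.sum_right {ι : Type*} {φ : Equit F →ₗ[F] L} {ψ χ : ι → (Equit F →ₗ[F] L)}
    (s : Finset ι) (h : ∀ i ∈ s, Mul φ (ψ i) (χ i)) : Mul φ (∑ i ∈ s, ψ i) (∑ i ∈ s, χ i) := by
  classical
  induction s using Finset.induction_on with
  | empty => simpa using Mul.zero_right φ
  | insert a s ha ih =>
    rw [Finset.sum_insert ha, Finset.sum_insert ha]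
    exact (h a (by simp)).add_right (ih fun i hi => h i (by simp [hi]))

theorem mul_of_basis (i : Fin 3) {φ ψ χ : Equit F →ₗ[F] L}
    (hbb : ⁅φ (b i), ψ (b i)⁆ = 0) (hbu : ⁅φ (b i), ψ (up i)⁆ = (2 : F) • χ (up i))
    (hbd : ⁅φ (b i), ψ (down i)⁆ = (-2 : F) • χ (down i))
    (hub : ⁅φ (up i), ψ (b i)⁆ = (-2 : F) • χ (up i))
    (huu : ⁅φ (up i), ψ (up i)⁆ = 0) (hud : ⁅φ (up i), ψ (down i)⁆ = (-4 : F) • χ (b i))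
    (hdb : ⁅φ (down i), ψ (b i)⁆ = (2 : F) • χ (down i))
    (hdu : ⁅φ (down i), ψ (up i)⁆ = (4 : F) • χ (b i))
    (hdd : ⁅φ (down i), ψ (down i)⁆ = 0) : Mul φ ψ χ := by
  intro p q
  refine bilin_ext (S := lieBilin φ ψ) (T := mapLie χ) i ?_ ?_ ?_ ?_ ?_ ?_ ?_ ?_ ?_ p q <;>
  simp only [lieBilin_apply, mapLie_apply, lie_b_up, lie_b_down, lie_up_down, lie_up_b,
    lie_down_b, lie_down_up, lie_self, map_smul, map_zero, *]

theorem mul_of_b {φ ψ χ : Equit F →ₗ[F] L}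
    (h : ∀ i j, ⁅φ (b i), ψ (b j)⁆ = χ ⁅(b i : Equit F), b j⁆) : Mul φ ψ χ := by
  intro p q
  rw [eq_sum_b p, eq_sum_b q]
  simp only [map_sum, map_smul, lie_sum, sum_lie, lie_smul, smul_lie, h]

/-- Equivariance of a bilinear map. -/
def BilinEquivariant (ι : Equit F →ₗ[F] L) (T : Equit F →ₗ[F] Equit F →ₗ[F] L) : Prop :=
  ∀ r p q, ⁅ι r, T p q⁆ = T ⁅r, p⁆ q + T p ⁅r, q⁆

theorem bilinEquivariant_lieBilin {ι φ ψ : Equit F →ₗ[F] L} (hφ : Mul ι φ φ) (hψ : Mul ι ψ ψ) :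
    BilinEquivariant ι (lieBilin φ ψ) := fun r p q => by
  simp only [lieBilin_apply]; rw [leibniz_lie, hφ, hψ]

theorem bilinEquivariant_mapLie {ι χ : Equit F →ₗ[F] L} (hχ : Mul ι χ χ) :
    BilinEquivariant ι (mapLie χ) := fun r p q => by
  simp only [mapLie_apply]; rw [hχ, leibniz_lie, map_add]

theorem BilinEquivariant.sub {ι : Equit F →ₗ[F] L} {S T : Equit F →ₗ[F] Equit F →ₗ[F] L}
    (hS : BilinEquivariant ι S) (hT : BilinEquivariant ι T) : BilinEquivariant ι (S - T) :=
  fun r p q => by simp only [LinearMap.sub_apply, lie_sub, hS r p q, hT r p q]; abel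

theorem eq_zero_of_smul_eq {a : F} (ha : a ≠ 0) {v w : L} (hw : w = 0) (h : w = a • v) :
    v = 0 := by
  rw [hw] at h
  exact (smul_eq_zero.mp h.symm).resolve_left ha

theorem Mul.lie_jacobi {φ ψ χ A B C : Equit F →ₗ[F] L} (hA : Mul φ ψ A) (hB : Mul ψ χ B)
    (hC : Mul φ χ C) (p q r : Equit F) :
    ⁅φ p, B ⁅q, r⁆⁆ + ⁅ψ q, C ⁅r, p⁆⁆ + ⁅χ r, A ⁅p, q⁆⁆ = 0 := by
  rw [← hA, ← hB, ← hC.symm]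
  exact _root_.lie_jacobi _ _ _

variable [CharZero F]

/-- Perfectness of sl₂: maps are determined by their values on brackets, so products in the sense of
`Mul` are unique. -/
theorem exists_lie_eq (i : Fin 3) (r : Equit F) : ∃ p q p' q' p'' q'' : Equit F,
    r = ⁅p, q⁆ + ⁅p', q'⁆ + ⁅p'', q''⁆ := by
  refine ⟨(-(r i - r (i + 1) - r (i + 2)) / 4) • up i, down i, (r (i + 1) / 2) • b i, up i,
    (-(r (i + 2)) / 2) • b i, down i, ?_⟩
  conv_lhs => rw [eq_combination i r]
  simp only [smul_lie, lie_up_down, lie_b_up, lie_b_down, smul_smul]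
  congr 1
  · congr 1 <;> congr 1 <;> ring
  · congr 1; ring

theorem hom_ext_lie {φ ψ : Equit F →ₗ[F] L}
    (h : ∀ p q : Equit F, φ ⁅p, q⁆ = ψ ⁅p, q⁆) : φ = ψ := by
  ext r
  obtain ⟨p, q, p', q', p'', q'', rfl⟩ := exists_lie_eq 0 r
  simp only [map_add, h]

theorem Mul.unique {φ ψ χ χ' : Equit F →ₗ[F] L} (h : Mul φ ψ χ) (h' : Mul φ ψ χ') : χ = χ' :=
  hom_ext_lie fun p q => by rw [← h, ← h']

/-- If two of the three ways to form a triple product agree, so does the third. -/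
theorem Mul.assoc {φ ψ χ A B C D : Equit F →ₗ[F] L} (hA : Mul φ ψ A) (hB : Mul ψ χ B)
    (hC : Mul φ χ C) (hBD : Mul φ B D) (hCD : Mul ψ C D) : Mul χ A D := by
  intro r s
  have key : ∀ p q, ⁅χ r, A ⁅p, q⁆⁆ = D ⁅r, ⁅p, q⁆⁆ := fun p q => by
    rw [← hA, leibniz_lie (χ r), hC.symm, hB.symm, hBD, hCD.symm, ← map_add, ← leibniz_lie]
  obtain ⟨p, q, p', q', p'', q'', rfl⟩ := exists_lie_eq 0 s
  simp only [map_add, lie_add, key]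

/-- This is associativity with the unit ι as one of the three factors. -/
theorem Mul.equivariant {ι φ ψ χ : Equit F →ₗ[F] L} (h : Mul φ ψ χ) (hφ : Mul ι φ φ)
    (hψ : Mul ι ψ ψ) : Mul ι χ χ :=
  Mul.assoc h hψ.symm hφ.symm h h.symm

/-- The tensor `down i ⊗ up i` is a cyclic vector of the tensor square of the adjoint module:
raising and lowering reach all nine basis tensors from it. -/
theorem BilinEquivariant.eq_zero {ι : Equit F →ₗ[F] L} {T : Equit F →ₗ[F] Equit F →ₗ[F] L}
    (hT : BilinEquivariant ι T) (i : Fin 3) (h0 : T (down i) (up i) = 0) : T = 0 := by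
  have hh := fun r p q (h : T p q = 0) => show T ⁅r, p⁆ q + T p ⁅r, q⁆ = 0 by
    rw [← hT, h, lie_zero]
  have hbu : T (b i) (up i) = 0 := by
    have := hh (up i) _ _ h0
    simp only [lie_up_down, lie_self, map_smul, map_zero, LinearMap.smul_apply, add_zero] at this
    exact eq_zero_of_smul_eq (a := (-4 : F)) (by norm_num) this rfl
  have huu : T (up i) (up i) = 0 := by
    have := hh (up i) _ _ hbu
    simp only [lie_up_b, lie_self, map_smul, map_zero, LinearMap.smul_apply, add_zero] at this
    exact eq_zero_of_smul_eq (a := (-2 : F)) (by norm_num) this rfl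
  have hdb : T (down i) (b i) = 0 := by
    have := hh (down i) _ _ h0
    simp only [lie_down_up, lie_self, map_smul, map_zero, LinearMap.zero_apply, zero_add] at this
    exact eq_zero_of_smul_eq (a := (4 : F)) (by norm_num) this rfl
  have hdd : T (down i) (down i) = 0 := by
    have := hh (down i) _ _ hdb
    simp only [lie_down_b, lie_self, map_smul, map_zero, LinearMap.zero_apply, zero_add] at this
    exact eq_zero_of_smul_eq (a := (2 : F)) (by norm_num) this rfl
  have hbb : T (b i) (b i) = 0 := by
    have := hh (down i) _ _ hbu
    simp only [lie_down_up, lie_down_b, h0, map_smul, LinearMap.smul_apply, smul_zero,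
      zero_add] at this
    exact eq_zero_of_smul_eq (a := (4 : F)) (by norm_num) this rfl
  have hub : T (up i) (b i) = 0 := by
    have := hh (down i) _ _ huu
    simp only [lie_down_up, hbu, map_smul, LinearMap.smul_apply, smul_zero, zero_add] at this
    exact eq_zero_of_smul_eq (a := (4 : F)) (by norm_num) this rfl
  have hud : T (up i) (down i) = 0 := by
    have := hh (down i) _ _ hub
    simp only [lie_down_up, lie_down_b, hbb, map_smul, LinearMap.smul_apply, smul_zero,
      zero_add] at this
    exact eq_zero_of_smul_eq (a := (2 : F)) (by norm_num) this rfl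
  have hbd : T (b i) (down i) = 0 := by
    have := hh (up i) _ _ hdd
    simp only [lie_up_down, hdb, map_smul, LinearMap.smul_apply, smul_zero, add_zero] at this
    exact eq_zero_of_smul_eq (a := (-4 : F)) (by norm_num) this rfl
  ext p q
  exact bilin_ext (T := 0) i hbb hbu hbd hub huu hud hdb h0 hdd p q

/-- An equivariant bilinear map without a five-dimensional component. -/
theorem BilinEquivariant.exists_eq {ι : Equit F →ₗ[F] L} {T : Equit F →ₗ[F] Equit F →ₗ[F] L}
    (hT : BilinEquivariant ι T) (i : Fin 3) (huu : T (up i) (up i) = 0) :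
    ∃ (χ : Equit F →ₗ[F] L) (c : L), ∀ p q, T p q = χ ⁅p, q⁆ + form p q • c := by
  have hh := fun r p q => (hT r p q).symm
  -- The tensor square of sl₂ splits into dimensions 5, 3 and 1. Repeatedly lowering `T (up i) (up
  -- i) = 0` gives the vanishing of T on the five-dimensional part, one weight at a time.
  have hub : T (up i) (b i) = - T (b i) (up i) := by
    have := hh (down i) (up i) (up i)
    simp only [lie_down_up, map_smul, LinearMap.smul_apply, huu, lie_zero, ← smul_add] at this
    rw [eq_neg_iff_add_eq_zero, add_comm]
    exact eq_zero_of_smul_eq (a := (4 : F)) (by norm_num) this rfl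
  have hbb : T (b i) (b i) = -(1 / 4 : F) • (T (up i) (down i) + T (down i) (up i)) := by
    have h1 := hh (down i) (up i) (b i)
    have h2 := hh (down i) (b i) (up i)
    simp only [lie_down_up, lie_down_b, map_smul, LinearMap.smul_apply] at h1 h2
    rw [hub, lie_neg] at h1
    linear_combination (norm := module) (1 / 8 : F) • h1 + (1 / 8 : F) • h2
  have hsym : T (b i) (down i) + T (down i) (b i) = 0 := by
    have h1 := hh (down i) (b i) (b i)
    have h2 := hh (down i) (up i) (down i)
    have h3 := hh (down i) (down i) (up i)
    simp only [lie_down_up, lie_down_b, map_smul, LinearMap.smul_apply, lie_self, map_zero,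
      LinearMap.zero_apply, add_zero, zero_add] at h1 h2 h3
    rw [hbb, lie_smul, lie_add, ← h2, ← h3] at h1
    linear_combination (norm := module) (1 / 3 : F) • h1
  have hdd : T (down i) (down i) = 0 := by
    have h1 := hh (down i) (b i) (down i)
    have h2 := hh (down i) (down i) (b i)
    simp only [lie_down_b, map_smul, LinearMap.smul_apply, lie_self, map_zero,
      LinearMap.zero_apply, add_zero, zero_add] at h1 h2
    have h3 : ⁅ι (down i), T (b i) (down i) + T (down i) (b i)⁆ = 0 := by rw [hsym, lie_zero]
    rw [lie_add, ← h1, ← h2] at h3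
    linear_combination (norm := module) (1 / 4 : F) • h3
  -- The bracket and the form project onto the two remaining parts. The coefficients invert the
  -- structure constants 4, 2, -2, and the scalar is `T (b i) (b i)` because `b i` brackets to zero
  -- with itself and has norm 1.
  obtain ⟨χ, hχb, hχu, hχd⟩ := exists_hom_weight (F := F) i
    ((1 / 8 : F) • (T (down i) (up i) - T (up i) (down i))) ((1 / 2 : F) • T (b i) (up i))
    ((-1 / 2 : F) • T (b i) (down i))
  refine ⟨χ, T (b i) (b i), ?_⟩
  refine bilin_ext (S := T) (T := mapLie χ + formSmul (T (b i) (b i))) i ?_ ?_ ?_ ?_ ?_ ?_ ?_ ?_ ?_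
  all_goals simp only [LinearMap.add_apply, mapLie_apply, formSmul_apply, lie_b_up, lie_b_down,
    lie_up_down, lie_up_b, lie_down_b, lie_down_up, lie_self, map_smul, map_zero, form_b_b,
    form_b_up, form_b_down, form_up_b, form_up_down, form_up_up, form_down_b, form_down_up,
    form_down_down, hχb, hχu, hχd, huu, hub, hdd]
  · module
  · module
  · module
  · module
  · module
  · rw [hbb]; module
  · linear_combination (norm := module) hsym
  · rw [hbb]; module
  · module

theorem exists_mulForm {ι φ ψ : Equit F →ₗ[F] L} (hφ : Mul ι φ φ) (hψ : Mul ι ψ ψ) (i : Fin 3)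
    (h : ⁅φ (up i), ψ (up i)⁆ = 0) : ∃ χ c, MulForm φ ψ χ c :=
  (bilinEquivariant_lieBilin hφ hψ).exists_eq i h

/-- The highest weight components of the triple products of `φ, ψ, χ` agree. -/
theorem Mul.lie_up_eq {φ ψ χ A B C : Equit F →ₗ[F] L} (hA : Mul φ ψ A) (hB : Mul ψ χ B)
    (hC : Mul φ χ C) (i : Fin 3) : ⁅φ (up i), B (up i)⁆ = ⁅ψ (up i), C (up i)⁆ := by
  have := Mul.lie_jacobi hA hB hC (up i) (up i) (b i)
  simp only [lie_up_b, lie_b_up, lie_self, map_smul, map_zero, lie_smul, lie_zero] at this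
  linear_combination (norm := module) (-1 / 2 : F) • this

theorem Mul.mulForm_eq {φ ψ χ A B C D D' D'' : Equit F →ₗ[F] L} {c c' c'' : L}
    (hA : Mul φ ψ A) (hB : Mul ψ χ B) (hC : Mul φ χ C) (hD : MulForm φ B D c)
    (hD' : MulForm ψ C D' c') (hD'' : MulForm χ A D'' c'') :
    c + c' + c'' = 0 ∧ D' = D'' := by
  -- The two Jacobi identities differ by exchanging `up i` and `down i`. Their difference isolates
  -- the scalar parts, their sum the adjoint parts.
  have key : ∀ i, c + c' + c'' = 0 ∧ D' (b i) = D'' (b i) := fun i => by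
    have h1 := Mul.lie_jacobi hA hB hC (b i) (up i) (down i)
    have h2 := Mul.lie_jacobi hA hB hC (b i) (down i) (up i)
    rw [hD, hD', hD''] at h1 h2
    simp only [lie_b_up, lie_b_down, lie_up_down, lie_up_b, lie_down_b, lie_down_up, lie_self,
      lie_smul, map_smul, smul_zero, map_zero, form_smul_right, form_down_up, form_up_down,
      form_b_b] at h1 h2
    constructor
    · linear_combination (norm := module) (-1 / 8 : F) • h1 + (1 / 8 : F) • h2
    · linear_combination (norm := module) (-1 / 16 : F) • h1 + (-1 / 16 : F) • h2
  exact ⟨(key 0).1, hom_ext fun i => (key i).2⟩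

end Equit

/-! ### Powers of an equivariant map. -/

namespace Equit

variable {F L : Type*} [Field F] [LieRing L] [LieAlgebra F L]

/-- The powers of an equivariant map `a` with respect to the product `Mul`, as far as they exist. -/
def power (ι a : Equit F →ₗ[F] L) : ℕ → (Equit F →ₗ[F] L)
  | 0 => ι
  | n + 1 => Classical.epsilon (Mul a (power ι a n))

@[simp] theorem power_zero (ι a : Equit F →ₗ[F] L) : power ι a 0 = ι := rfl

/-- Powers are chosen before they are known to exist, so existence can be established during the
induction in `mul_power`. -/
theorem mul_power_succ_of_exists {ι a χ : Equit F →ₗ[F] L} {n : ℕ} (h : Mul a (power ι a n) χ) :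
    Mul a (power ι a n) (power ι a (n + 1)) :=
  Classical.epsilon_spec (p := Mul a (power ι a n)) ⟨χ, h⟩

theorem MulForm.lie_b {φ ψ χ : Equit F →ₗ[F] L} {c : L} (h : MulForm φ ψ χ c) (i : Fin 3) :
    ⁅φ (b i), ψ (b i)⁆ = c := by
  rw [h]; simp [form_b_b]

variable [CharZero F]

@[simp] theorem power_one {ι a : Equit F →ₗ[F] L} (ha : Mul ι a a) : power ι a 1 = a :=
  (mul_power_succ_of_exists (ι := ι) (n := 0) ha.symm).unique ha.symm

theorem eq_zero_of_eq_neg_self (F : Type*) {L : Type*} [Field F] [CharZero F] [AddCommGroup L]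
    [Module F L] {v : L} (h : v = -v) : v = 0 := by
  have h2 : (2 : F) • v = 0 := by linear_combination (norm := module) h
  exact (smul_eq_zero.mp h2).resolve_left two_ne_zero

/-- The weight-four part of the product of `P m` and `P n` depends only on m + n, by the Jacobi
identity, and it is antisymmetric in m and n. So it vanishes, except that total degree 3 is too
small for this argument; there it is the Dolan-Grady input `hcube`. -/
theorem lie_up_power_eq_zero {P : ℕ → (Equit F →ₗ[F] L)} {i : Fin 3} {N : ℕ}
    (hcube : ⁅P 1 (up i), ⁅P 1 (up i), P 1 (b i)⁆⁆ = 0)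
    (hP : ∀ m n, m + n < N → Mul (P m) (P n) (P (m + n)))
    {m n : ℕ} (hm : 1 ≤ m) (hn : 1 ≤ n) (hmn : m + n = N) :
    ⁅P m (up i), P n (up i)⁆ = 0 := by
  have step : ∀ k l, 1 ≤ k → 1 ≤ l → k + l + 1 = N →
      ⁅P 1 (up i), P (k + l) (up i)⁆ = ⁅P k (up i), P (l + 1) (up i)⁆ := fun k l hk hl h => by
    refine Mul.lie_up_eq (hP 1 k (by omega)) (hP k l (by omega)) ?_ i
    rw [add_comm l]; exact hP 1 l (by omega)
  have one : ∀ n, 1 ≤ n → n + 1 = N → ⁅P 1 (up i), P n (up i)⁆ = 0 := by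
    intro n hn h
    obtain rfl | rfl | h3 : n = 1 ∨ n = 2 ∨ 3 ≤ n := by omega
    · exact lie_self _
    · have h2 := hP 1 1 (by omega) (up i) (b i)
      rw [h2, lie_up_b, map_smul, lie_smul] at hcube
      exact eq_zero_of_smul_eq (a := (-2 : F)) (by norm_num) hcube rfl
    · obtain ⟨l, rfl⟩ := Nat.exists_eq_add_of_le' h3
      -- The bracket for (1, l + 3) equals those for (2, l + 2) and (l + 2, 2), which are opposite.
      have e1 := step 2 (l + 1) (by omega) (by omega) (by omega)
      have e2 := step (l + 1 + 1) 1 (by omega) (by omega) (by omega)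
      rw [show l + 3 = 2 + (l + 1) by omega]
      rw [show l + 1 + 1 + 1 = 2 + (l + 1) by omega] at e2
      refine eq_zero_of_eq_neg_self F ?_
      nth_rw 1 [e2]
      rw [e1, lie_skew]
  obtain rfl | h2 : n = 1 ∨ 2 ≤ n := by omega
  · rw [← lie_skew, one m hm hmn, neg_zero]
  · obtain ⟨l, rfl⟩ := Nat.exists_eq_add_of_le' h2
    rw [show l + 2 = (l + 1) + 1 by omega, ← step m (l + 1) hm (by omega) (by omega)]
    exact one _ (by omega) (by omega)

/-- The Onsager algebra: the powers of `a` multiply as the powers of an indeterminate. -/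
theorem mul_power {ι a : Equit F →ₗ[F] L} (hι : Mul ι ι ι) (ha : Mul ι a a) {i : Fin 3}
    (hcube : ⁅a (up i), ⁅a (up i), a (b i)⁆⁆ = 0) (m n : ℕ) :
    Mul (power ι a m) (power ι a n) (power ι a (m + n)) := by
  induction hN : m + n using Nat.strong_induction_on generalizing m n with
  | _ N ih =>
  subst hN
  set P := power ι a with hPdef
  have hP1 : P 1 = a := power_one ha
  set N := m + n with hN
  have hP : ∀ m n, m + n < N → Mul (P m) (P n) (P (m + n)) := fun k l h => ih _ h k l rfl
  clear_value N
  obtain h0 | h1 | h2 : N = 0 ∨ N = 1 ∨ 2 ≤ N := by omega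
  · obtain ⟨rfl, rfl⟩ : m = 0 ∧ n = 0 := by omega
    subst h0; exact hι
  · subst h1
    obtain ⟨rfl, rfl⟩ | ⟨rfl, rfl⟩ : m = 0 ∧ n = 1 ∨ m = 1 ∧ n = 0 := by omega
    · rw [hP1]; exact ha
    · rw [hP1]; exact ha.symm
  have heq : ∀ k, k < N → Mul ι (P k) (P k) := fun k hk => by
    have := hP 0 k (by omega)
    rwa [zero_add] at this
  -- Without a weight-four part, each product of total degree N is an adjoint part `D k` plus a
  -- scalar part `c k`. It remains to show that `c k` vanishes and that `D k` does not depend on k.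
  have hex : ∀ k, ∃ D c, 1 ≤ k → k < N → MulForm (P k) (P (N - k)) D c := by
    intro k
    by_cases hk : 1 ≤ k ∧ k < N
    · obtain ⟨D, c, h⟩ := exists_mulForm (heq k hk.2) (heq (N - k) (by omega)) i
        (lie_up_power_eq_zero (P := P) (by rwa [hP1]) hP hk.1 (by omega) (by omega))
      exact ⟨D, c, fun _ _ => h⟩
    · exact ⟨0, 0, fun h h' => absurd ⟨h, h'⟩ hk⟩
  choose D c hD using hex
  have hskew : ∀ k, 1 ≤ k → k < N → c (N - k) = - c k := fun k hk hk' => by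
    have e := (hD (N - k) (by omega) (by omega)).lie_b 0
    rw [Nat.sub_sub_self hk'.le] at e
    rw [← e, ← (hD k hk hk').lie_b 0, lie_skew]
  have hjac : ∀ k l, 1 ≤ k → 1 ≤ l → k + l + 1 = N → c k + c 1 + c l = 0 ∧ D 1 = D l := by
    intro k l hk hl h
    have d1 := hD k hk (by omega)
    have d2 := hD 1 (by omega) (by omega)
    have d3 := hD l hl (by omega)
    rw [show N - k = 1 + l by omega] at d1
    rw [show N - 1 = k + l by omega] at d2
    rw [show N - l = k + 1 by omega] at d3
    exact Mul.mulForm_eq (hP k 1 (by omega)) (hP 1 l (by omega)) (hP k l (by omega)) d1 d2 d3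
  -- Jacobi and skew symmetry make `c` additive, as for the central cocycle of a loop algebra.
  -- Comparing k = N - 1 with `c (N - 1) = -c 1` then gives `N • c 1 = 0`.
  have hc : ∀ k, 1 ≤ k → k < N → c k = (k : F) • c 1 := by
    intro k hk
    induction k, hk using Nat.le_induction with
    | base => intro _; simp
    | succ k hk ihk =>
      intro hk'
      have e1 := (hjac k (N - (k + 1)) hk (by omega) (by omega)).1
      rw [hskew (k + 1) (by omega) hk', ihk (by omega)] at e1
      push_cast
      linear_combination (norm := module) -e1
  have hc1 : c 1 = 0 := by
    have e1 := hc (N - 1) (by omega) (by omega)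
    rw [hskew 1 (by omega) (by omega), Nat.cast_sub (by omega)] at e1
    refine eq_zero_of_smul_eq (a := (N : F)) (Nat.cast_ne_zero.mpr (by omega)) rfl ?_
    push_cast at e1
    linear_combination (norm := module) e1
  have hmul : ∀ k, 1 ≤ k → k < N → Mul (P k) (P (N - k)) (D k) := fun k hk hk' => by
    have := hD k hk hk'
    rwa [hc k hk hk', hc1, smul_zero, mulForm_zero] at this
  have h1 : Mul (P 1) (P (N - 1)) (P N) := by
    have := hmul 1 (by omega) (by omega)
    rw [hP1] at this
    have := mul_power_succ_of_exists this
    rw [← hPdef, Nat.sub_add_cancel (by omega)] at this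
    rwa [hP1]
  have hD1 : D 1 = P N := (hmul 1 (by omega) (by omega)).unique h1
  have h0 : Mul ι (P N) (P N) := h1.equivariant (heq 1 (by omega)) (heq (N - 1) (by omega))
  obtain rfl | rfl | rfl | ⟨hm, hn⟩ : m = 0 ∨ n = 0 ∨ n = 1 ∨ (1 ≤ m ∧ 2 ≤ n) := by omega
  · rw [zero_add] at hN; rw [← hN]; exact h0
  · rw [add_zero] at hN; rw [← hN]; exact h0.symm
  · rw [show m = N - 1 by omega]; exact h1.symm
  · have := hmul m hm (by omega)
    rwa [← (hjac (n - 1) m (by omega) hm (by omega)).2, hD1, show N - m = n by omega] at this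

/-- From a a' = a - 1 follows a' aⁿ⁺¹ = aⁿ⁺¹ - aⁿ, by induction with `Mul.assoc`. -/
theorem mul_next_power {ι a a' : Equit F →ₗ[F] L} (ha : Mul ι a a)
    (hP : ∀ m n, Mul (power ι a m) (power ι a n) (power ι a (m + n)))
    (haa' : Mul a a' (a - ι)) (n : ℕ) :
    Mul a' (power ι a (n + 1)) (power ι a (n + 1) - power ι a n) := by
  have h1 := power_one ha
  have hl : ∀ n, Mul a (power ι a n) (power ι a (n + 1)) := fun n => by
    have := hP 1 n; rwa [h1, add_comm] at this
  induction n with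
  | zero => rw [zero_add, h1]; exact haa'.symm
  | succ n ih =>
    exact Mul.assoc (hl (n + 1)) ih.symm haa' ((hl (n + 1)).sub_right (hl n))
      ((hl (n + 1)).symm.sub_right (by simpa using hP (n + 1) 0))

/-- From a' a = a' - 1 follows a' aⁿ = a' - (1 + a + ⋯ + aⁿ⁻¹). -/
theorem mul_prev_power {ι a a' : Equit F →ₗ[F] L} (ha : Mul ι a a) (ha' : Mul ι a' a')
    (hP : ∀ m n, Mul (power ι a m) (power ι a n) (power ι a (m + n)))
    (haa' : Mul a' a (a' - ι)) (n : ℕ) :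
    Mul a' (power ι a n) (a' - ∑ k ∈ Finset.range n, power ι a k) := by
  have h1 := power_one ha
  have hl : ∀ n, Mul a (power ι a n) (power ι a (n + 1)) := fun n => by
    have := hP 1 n; rwa [h1, add_comm] at this
  induction n with
  | zero => simpa using ha'.symm
  | succ n ih =>
    refine Mul.assoc (hl n) ih.symm haa'.symm ?_ ?_
    · rw [Finset.sum_range_succ', sub_add_eq_sub_sub, sub_right_comm]
      exact haa'.symm.sub_right (Mul.sum_right _ fun k _ => hl k)
    · rw [Finset.sum_range_succ, sub_add_eq_sub_sub]
      exact ih.symm.sub_right (by simpa using hP n 0)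

end Equit

/-! ### From the tetrahedron relations to the maps for t₀, t₁, t₂. -/

namespace Equit

theorem fin_add_one_add_one (i : Fin 3) : i + 1 + 1 = i + 2 := by revert i; decide
theorem fin_add_one_add_two (i : Fin 3) : i + 1 + 2 = i := by revert i; decide
theorem fin_add_two_add_one (i : Fin 3) : i + 2 + 1 = i := by revert i; decide
theorem fin_add_two_add_two (i : Fin 3) : i + 2 + 2 = i + 1 := by revert i; decide

variable {F L : Type*} [Field F] [LieRing L] [LieAlgebra F L]

theorem lie_b_b_succ (i : Fin 3) :
    ⁅(b i : Equit F), b (i + 1)⁆ = (2 : F) • (b i : Equit F) + (2 : F) • b (i + 1) := by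
  rw [lie_b_succ, smul_add]

theorem lie_b_succ_b (i : Fin 3) :
    ⁅(b (i + 1) : Equit F), b i⁆ = (-2 : F) • (b i : Equit F) + (-2 : F) • b (i + 1) := by
  rw [← lie_skew, lie_b_succ]; module

theorem lie_b_b_add_two (i : Fin 3) :
    ⁅(b i : Equit F), b (i + 2)⁆ = (-2 : F) • (b i : Equit F) + (-2 : F) • b (i + 2) := by
  have := lie_b_succ_b (F := F) (i + 2)
  rw [fin_add_two_add_one] at this
  rw [this]; abel

theorem lie_b_add_two_b (i : Fin 3) :
    ⁅(b (i + 2) : Equit F), b i⁆ = (2 : F) • (b i : Equit F) + (2 : F) • b (i + 2) := by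
  rw [← lie_skew, lie_b_b_add_two]; module

theorem lie_b_succ_b_add_two (i : Fin 3) : ⁅(b (i + 1) : Equit F), b (i + 2)⁆
    = (2 : F) • (b (i + 1) : Equit F) + (2 : F) • b (i + 2) := by
  have := lie_b_b_succ (F := F) (i + 1)
  rwa [fin_add_one_add_one] at this

theorem lie_b_add_two_b_succ (i : Fin 3) : ⁅(b (i + 2) : Equit F), b (i + 1)⁆
    = (-2 : F) • (b (i + 1) : Equit F) + (-2 : F) • b (i + 2) := by
  rw [← lie_skew, lie_b_succ_b_add_two]; module

theorem fin_cases_add (i j : Fin 3) : j = i ∨ j = i + 1 ∨ j = i + 2 := by revert i j; decide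

theorem mul_lift {s : Fin 3 → L}
    (h : ∀ i, ⁅s i, s (i + 1)⁆ = (2 : F) • s i + (2 : F) • s (i + 1)) :
    Mul (lift (F := F) s) (lift s) (lift s) := by
  refine mul_of_b fun i j => ?_
  obtain rfl | rfl | rfl := fin_cases_add i j
  · simp
  · simp [lie_b_b_succ, h]
  · have := h (i + 2)
    rw [fin_add_two_add_one] at this
    rw [lie_b_b_add_two, ← lie_skew]
    simp only [lift_b, map_add, map_smul, this]
    module

variable [CharZero F]

/-- A highest weight vector of weight two killed by the cube of the lowering operator generates a
copy of the adjoint module. -/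
theorem exists_equivariant_of_highest_weight {ι : Equit F →ₗ[F] L} (hι : Mul ι ι ι) {i : Fin 3}
    {v : L} (hb : ⁅ι (b i), v⁆ = (2 : F) • v) (hu : ⁅ι (up i), v⁆ = 0)
    (hd : ⁅ι (down i), ⁅ι (down i), ⁅ι (down i), v⁆⁆⁆ = 0) :
    ∃ a : Equit F →ₗ[F] L, Mul ι a a ∧ a (up i) = v := by
  -- The factors 1/4 and 1/8 are forced by equivariance, since `down i` sends `up i` to `4 • b i`
  -- and `b i` to `2 • down i`.
  obtain ⟨a, ab, au, ad⟩ := exists_hom_weight (F := F) i ((1 / 4 : F) • ⁅ι (down i), v⁆) v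
    ((1 / 8 : F) • ⁅ι (down i), ⁅ι (down i), v⁆⁆)
  have hbd : ⁅ι (b i), ⁅ι (down i), v⁆⁆ = 0 := by
    rw [leibniz_lie, hι, lie_b_down, hb, map_smul, smul_lie, lie_smul]; module
  have hbdd : ⁅ι (b i), ⁅ι (down i), ⁅ι (down i), v⁆⁆⁆
      = (-2 : F) • ⁅ι (down i), ⁅ι (down i), v⁆⁆ := by
    rw [leibniz_lie, hι, lie_b_down, hbd, map_smul, smul_lie, lie_zero, add_zero]
  have hud : ⁅ι (up i), ⁅ι (down i), v⁆⁆ = (-8 : F) • v := by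
    rw [leibniz_lie, hι, lie_up_down, hu, map_smul, smul_lie, lie_zero, hb]; module
  have hudd : ⁅ι (up i), ⁅ι (down i), ⁅ι (down i), v⁆⁆⁆ = (-8 : F) • ⁅ι (down i), v⁆ := by
    rw [leibniz_lie, hι, lie_up_down, hud, map_smul, smul_lie, hbd, lie_smul]; module
  refine ⟨a, mul_of_basis i ?_ ?_ ?_ ?_ ?_ ?_ ?_ ?_ ?_, au⟩
  all_goals simp only [ab, au, ad, lie_smul, hb, hu, hd, hbd, hbdd, hud, hudd, smul_zero]
  all_goals module

/-- The relations among the elements `x₁₂, x₂₃, x₃₁` (the `s i`) and `x₀₃, x₀₁, x₀₂` (the `y i`). -/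
structure TetRel (F : Type*) {L : Type*} [Field F] [LieRing L] [LieAlgebra F L]
    (s y : Fin 3 → L) : Prop where
  lie_s_s : ∀ i, ⁅s i, s (i + 1)⁆ = (2 : F) • s i + (2 : F) • s (i + 1)
  lie_s_y : ∀ i, ⁅s (i + 1), y i⁆ = (2 : F) • y i - (2 : F) • s (i + 1)
  lie_s_y' : ∀ i, ⁅s (i + 2), y i⁆ = (-2 : F) • y i - (2 : F) • s (i + 2)
  lie_y_y : ∀ i, ⁅y i, y (i + 1)⁆ = (2 : F) • y i - (2 : F) • y (i + 1)
  cube_s : ∀ i, ⁅s i, ⁅s i, ⁅s i, y i⁆⁆⁆ = (4 : F) • ⁅s i, y i⁆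
  cube_y : ∀ i, ⁅y i, ⁅y i, ⁅y i, s i⁆⁆⁆ = (4 : F) • ⁅y i, s i⁆

namespace TetRel

variable {s y : Fin 3 → L}

/-- The vector `y i + s (i + 2)` has highest weight two for `s (i + 1)`. The Dolan-Grady relation
`cube_s` says that the cube of the lowering operator kills it. -/
theorem exists_equivariant (h : TetRel F s y) (i : Fin 3) :
    ∃ a : Equit F →ₗ[F] L, Mul (lift s) a a ∧ a (up (i + 1)) = y i + s (i + 2) := by
  have hι := mul_lift h.lie_s_s
  have hss := h.lie_s_s (i + 1)
  rw [fin_add_one_add_one] at hss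
  have hb : ⁅lift s (b (i + 1) : Equit F), y i + s (i + 2)⁆ = (2 : F) • (y i + s (i + 2)) := by
    rw [lift_b, lie_add, h.lie_s_y, hss]; module
  have hbd : ⁅s (i + 1), ⁅lift s (down (i + 1) : Equit F), y i + s (i + 2)⁆⁆ = 0 := by
    rw [← lift_b (F := F) s (i + 1), leibniz_lie, hι, lie_b_down, hb, map_smul, smul_lie,
      lie_smul]; module
  have hbdd : ⁅s (i + 1), ⁅lift s (down (i + 1) : Equit F),
        ⁅lift s (down (i + 1) : Equit F), y i + s (i + 2)⁆⁆⁆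
      = (-2 : F) • ⁅lift s (down (i + 1) : Equit F),
        ⁅lift s (down (i + 1) : Equit F), y i + s (i + 2)⁆⁆ := by
    rw [← lift_b (F := F) s (i + 1), leibniz_lie, hι, lie_b_down, lift_b, hbd, map_smul,
      smul_lie, lie_zero, add_zero]
  have hs : s i = lift s (down (i + 1) : Equit F) - s (i + 1) := by
    simp [down, fin_add_one_add_two]
  refine exists_equivariant_of_highest_weight hι hb ?_ ?_
  · simp only [up, fin_add_one_add_one, map_add, lift_b, lie_add, add_lie, h.lie_s_y,
      h.lie_s_y', hss, lie_self]
    module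
  · have hc : ⁅s i, ⁅s i, ⁅s i, y i + s (i + 2)⁆⁆⁆ = (4 : F) • ⁅s i, y i + s (i + 2)⁆ := by
      have hsi := h.lie_s_s (i + 2)
      rw [fin_add_two_add_one, ← lie_skew, neg_eq_iff_eq_neg] at hsi
      simp only [lie_add, h.cube_s, hsi, lie_neg, lie_smul, lie_self, lie_zero]
      module
    rw [lift_b] at hb
    rw [hs] at hc
    simp only [sub_lie, lie_sub, lie_smul, hb, hbd, hbdd, lie_zero] at hc
    linear_combination (norm := module) hc

/-- This is t_i t_{i+1} = t_i - 1. By `BilinEquivariant.eq_zero` a single bracket suffices, and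
since `down (i + 2) = up (i + 1)` it is the one governed by `lie_y_y`. -/
theorem mul_succ (h : TetRel F s y) {a a' : Equit F →ₗ[F] L} {i : Fin 3}
    (ha : Mul (lift s) a a) (ha' : Mul (lift s) a' a') (hy : a (up (i + 1)) = y i + s (i + 2))
    (hy' : a' (up (i + 2)) = y (i + 1) + s i) : Mul a a' (a - lift s) := by
  have hι := mul_lift h.lie_s_s
  have hsub : Mul (lift s) (a - lift s) (a - lift s) := ha.sub_right hι
  have hT := (bilinEquivariant_lieBilin ha ha').sub (bilinEquivariant_mapLie hsub)
  have hdown : (down (i + 2) : Equit F) = up (i + 1) := by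
    simp only [down, up, fin_add_two_add_two, fin_add_one_add_one]; abel
  have hz := hT.eq_zero (i + 2) ?_
  · intro p q
    have := LinearMap.congr_fun₂ hz p q
    simpa [sub_eq_zero] using this
  · have h1 : ⁅y i + s (i + 2), s i⁆ = a ⁅(up (i + 1) : Equit F), b i⁆ := by
      rw [← ha.symm, hy, lift_b]
    have h2 : ⁅(up (i + 1) : Equit F), b i⁆ = (2 : F) • (b (i + 2) : Equit F) + (-2 : F) • b (i + 1) := by
      simp only [up, fin_add_one_add_one, add_lie, lie_b_succ_b, lie_b_add_two_b]; module
    rw [h2, map_add, map_smul, map_smul] at h1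
    have h3 := h.lie_s_y (i + 1)
    rw [fin_add_one_add_one] at h3
    simp only [LinearMap.sub_apply, lieBilin_apply, mapLie_apply, hdown, hy, hy']
    rw [← hdown, lie_down_up, lie_add, h1, add_lie, h.lie_y_y, h3]
    rw [up, map_add, fin_add_one_add_one] at hy
    simp only [map_smul, lift_b]
    linear_combination (norm := module) (2 : F) • (-hy)

/-- This is what `cube_y` says once `y i` and `s i` are expanded in weight vectors for `s (i + 2)`:
all other terms cancel. -/
theorem lie_lie_eq_zero (h : TetRel F s y) {a : Equit F →ₗ[F] L} {i : Fin 3}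
    (ha : Mul (lift s) a a) (hy : a (up (i + 1)) = y i + s (i + 2)) :
    ⁅a (up (i + 1)), ⁅a (up (i + 1)), a (b (i + 1))⁆⁆ = 0 := by
  have hι := mul_lift h.lie_s_s
  have hdown : (up (i + 1) : Equit F) = down (i + 2) := by
    simp only [down, up, fin_add_two_add_two, fin_add_one_add_one]; abel
  have hb : (b (i + 1) : Equit F) = down (i + 2) - b (i + 2) := by
    simp only [down, fin_add_two_add_two]; abel
  set u := lift s (up (i + 2) : Equit F) with hu
  have hs : s i = u - s (i + 2) := by simp [hu, up, fin_add_two_add_one]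
  rw [hdown] at hy ⊢
  rw [hb, map_sub, lie_sub, lie_self, zero_sub, lie_neg]
  have hyi : y i = a (down (i + 2)) - s (i + 2) := by rw [hy]; abel
  have c := h.cube_y i
  have e1 : ⁅a (down (i + 2)), u⁆ = (4 : F) • a (b (i + 2)) := by
    rw [ha.symm, lie_down_up, map_smul]
  have e2 : ⁅a (down (i + 2)), s (i + 2)⁆ = (2 : F) • a (down (i + 2)) := by
    rw [← lift_b (F := F) s, ha.symm, lie_down_b, map_smul]
  have e3 : ⁅s (i + 2), u⁆ = (2 : F) • u := by
    rw [← lift_b (F := F) s, hu, hι, lie_b_up, map_smul]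
  have e4 : ⁅s (i + 2), a (b (i + 2))⁆ = 0 := by
    rw [← lift_b (F := F) s, ha, lie_self, map_zero]
  have e5 : ⁅s (i + 2), a (down (i + 2))⁆ = (-2 : F) • a (down (i + 2)) := by
    rw [← lift_b (F := F) s, ha, lie_b_down, map_smul]
  have e6 : ⁅s (i + 2), ⁅a (down (i + 2)), a (b (i + 2))⁆⁆
      = (-2 : F) • ⁅a (down (i + 2)), a (b (i + 2))⁆ := by
    rw [leibniz_lie, e5, e4, smul_lie, lie_zero, add_zero]
  rw [hyi, hs] at c
  simp only [sub_lie, lie_sub, lie_smul, e1, e2, e3, e4, e5, e6, lie_self, lie_zero,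
    sub_zero] at c
  linear_combination (norm := module) (-1 / 4 : F) • c

end TetRel

end Equit

/-! ### Coordinate maps indexed by polynomials. -/

namespace Equit

open Polynomial

variable {F L : Type*} [Field F] [LieRing L] [LieAlgebra F L]

/-- The linear map on polynomials with prescribed values on the powers of `X`. -/
def polyMap (P : ℕ → (Equit F →ₗ[F] L)) : F[X] →ₗ[F] (Equit F →ₗ[F] L) :=
  (Polynomial.basisMonomials F).constr F P

@[simp] theorem polyMap_X_pow (P : ℕ → (Equit F →ₗ[F] L)) (n : ℕ) : polyMap P (X ^ n) = P n := by
  have hn : basisMonomials F n = X ^ n := by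
    rw [coe_basisMonomials, X_pow_eq_monomial]
  rw [← hn]
  exact (basisMonomials F).constr_basis F P n

theorem induction_X_pow {p : F[X] → Prop} (hadd : ∀ f g, p f → p g → p (f + g))
    (hsmul : ∀ (a : F) f, p f → p (a • f)) (hX : ∀ n, p (X ^ n)) (f : F[X]) : p f := by
  induction f using Polynomial.induction_on' with
  | add f g hf hg => exact hadd f g hf hg
  | monomial n a => rw [← smul_X_eq_monomial]; exact hsmul a _ (hX n)

theorem mul_polyMap {P : ℕ → (Equit F →ₗ[F] L)} (hP : ∀ m n, Mul (P m) (P n) (P (m + n)))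
    (f g : F[X]) : Mul (polyMap P f) (polyMap P g) (polyMap P (f * g)) := by
  induction g using induction_X_pow with
  | hadd g h hg hh => rw [mul_add, map_add, map_add]; exact hg.add_right hh
  | hsmul a g hg => rw [mul_smul_comm, map_smul, map_smul]; exact hg.smul_right a
  | hX n =>
    induction f using induction_X_pow with
    | hadd g h hg hh => rw [add_mul, map_add, map_add]; exact (hg.symm.add_right hh.symm).symm
    | hsmul a g hg => rw [smul_mul_assoc, map_smul, map_smul]; exact (hg.symm.smul_right a).symm
    | hX m => rw [← pow_add, polyMap_X_pow, polyMap_X_pow, polyMap_X_pow]; exact hP m n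

variable [CharZero F]

/-- The coordinate maps: `Φ c p` stands for `sl₂ ⊗ p(t_c)`, where `t_0, t_1, t_2` are
`t, 1 - t⁻¹, (1 - t)⁻¹`. -/
theorem TetRel.exists_coordinates {s y : Fin 3 → L} (h : TetRel F s y) :
    ∃ Φ : Fin 3 → F[X] →ₗ[F] (Equit F →ₗ[F] L),
      (∀ i, Φ i 1 = lift s) ∧ (∀ i, Φ i X (up (i + 1)) = y i + s (i + 2)) ∧
      (∀ i f g, Mul (Φ i f) (Φ i g) (Φ i (f * g))) ∧
      ∀ i j f, ∃ χ ∈ ⨆ k, LinearMap.range (Φ k), Mul (Φ j X) (Φ i f) χ := by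
  choose a ha hy using h.exists_equivariant
  have hι := mul_lift h.lie_s_s
  have hnext : ∀ i, Mul (a i) (a (i + 1)) (a i - lift s) := fun i => by
    refine h.mul_succ (ha i) (ha (i + 1)) (hy i) ?_
    rw [← fin_add_one_add_one, hy, fin_add_one_add_two]
  have hpow := fun i => mul_power hι (ha i) (h.lie_lie_eq_zero (ha i) (hy i))
  have hone : ∀ i, polyMap (power (lift s) (a i)) 1 = lift s := fun i => by
    rw [← pow_zero X, polyMap_X_pow, power_zero]
  have hX : ∀ i, polyMap (power (lift s) (a i)) X = a i := fun i => by
    rw [← pow_one X, polyMap_X_pow, power_one (ha i)]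
  set Φ := fun i => polyMap (power (lift s) (a i)) with hΦ
  have hmem : ∀ i f, Φ i f ∈ ⨆ k, LinearMap.range (Φ k) := fun i f =>
    Submodule.mem_iSup_of_mem i ⟨f, rfl⟩
  refine ⟨Φ, hone, fun i => by rw [hX, hy], fun i => mul_polyMap (hpow i), fun i j f => ?_⟩
  induction f using induction_X_pow with
  | hadd f g hf hg =>
    obtain ⟨χ, hχ, h1⟩ := hf
    obtain ⟨χ', hχ', h2⟩ := hg
    exact ⟨χ + χ', add_mem hχ hχ', by rw [map_add]; exact h1.add_right h2⟩
  | hsmul r f hf =>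
    obtain ⟨χ, hχ, h1⟩ := hf
    exact ⟨r • χ, Submodule.smul_mem _ r hχ, by rw [map_smul]; exact h1.smul_right r⟩
  | hX n =>
    have hn : Φ i (X ^ n) = power (lift s) (a i) n := polyMap_X_pow _ n
    obtain rfl | rfl | rfl := fin_cases_add i j
    · exact ⟨_, hmem j (X * X ^ n), mul_polyMap (hpow j) _ _⟩
    · rw [hX, hn]
      cases n with
      | zero => exact ⟨_, hX (i + 1) ▸ hmem (i + 1) X, (ha (i + 1)).symm⟩
      | succ n =>
        refine ⟨_, ?_, mul_next_power (ha i) (hpow i) (hnext i) n⟩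
        rw [← hn, ← polyMap_X_pow (power (lift s) (a i)) n]
        exact sub_mem (hmem i _) (hmem i _)
    · rw [hX, hn]
      have hp := hnext (i + 2)
      rw [fin_add_two_add_one] at hp
      refine ⟨_, ?_, mul_prev_power (ha i) (ha (i + 2)) (hpow i) hp n⟩
      refine sub_mem (hX (i + 2) ▸ hmem (i + 2) X) (sum_mem fun k _ => ?_)
      rw [← polyMap_X_pow (power (lift s) (a i)) k]
      exact hmem i _

end Equit

/-! ### The presentation and the evaluation homomorphisms. -/

namespace TetrahedronAlgebra

section Tet

variable (F : Type*) [Field F]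

theorem x_skew (i j : Fin 4) (hij : i ≠ j) : x F i j hij = - x F j i hij.symm := by
  rw [eq_neg_iff_add_eq_zero]
  exact (LieSubmodule.Quotient.mk_eq_zero' (N := relatorIdeal F)).mpr
    (LieSubmodule.subset_lieSpan (Relator.skew i j hij))

theorem x_triangle (h i j : Fin 4) (hhi : h ≠ i) (hij : i ≠ j) (hhj : h ≠ j) :
    ⁅x F h i hhi, x F i j hij⁆ = (2 : F) • x F h i hhi + (2 : F) • x F i j hij := by
  rw [← sub_eq_zero]
  exact (LieSubmodule.Quotient.mk_eq_zero' (N := relatorIdeal F)).mpr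
    (LieSubmodule.subset_lieSpan (Relator.triangle h i j hhi hij hhj))

theorem x_dolanGrady (h i j k : Fin 4) (hhi : h ≠ i) (hhj : h ≠ j) (hhk : h ≠ k)
    (hij : i ≠ j) (hik : i ≠ k) (hjk : j ≠ k) :
    ⁅x F h i hhi, ⁅x F h i hhi, ⁅x F h i hhi, x F j k hjk⁆⁆⁆
      = (4 : F) • ⁅x F h i hhi, x F j k hjk⁆ := by
  rw [← sub_eq_zero]
  exact (LieSubmodule.Quotient.mk_eq_zero' (N := relatorIdeal F)).mpr
    (LieSubmodule.subset_lieSpan (Relator.dolanGrady h i j k hhi hhj hhk hij hik hjk))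

/-- The map from the free Lie algebra to the tetrahedron algebra. -/
def ofFree : FreeLieAlgebra F Gen →ₗ⁅F⁆ Tet F where
  toFun a := LieSubmodule.Quotient.mk a
  map_add' _ _ := rfl
  map_smul' _ _ := rfl
  map_lie' := rfl

/-- The generators generate the tetrahedron algebra. -/
theorem lieSpan_x_eq_top :
    LieSubalgebra.lieSpan F (Tet F) (Set.range fun p : Gen => x F p.1.1 p.1.2 p.2) = ⊤ := by
  set S := LieSubalgebra.lieSpan F (Tet F) (Set.range fun p : Gen => x F p.1.1 p.1.2 p.2) with hS
  let g : FreeLieAlgebra F Gen →ₗ⁅F⁆ S := FreeLieAlgebra.lift F fun p =>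
    ⟨x F p.1.1 p.1.2 p.2, LieSubalgebra.subset_lieSpan ⟨p, rfl⟩⟩
  have hg : S.incl.comp g = ofFree F := FreeLieAlgebra.hom_ext fun p => by
    rw [LieHom.comp_apply, FreeLieAlgebra.lift_of_apply]; rfl
  rw [eq_top_iff]
  intro ξ _
  obtain ⟨a, rfl⟩ := LieSubmodule.Quotient.surjective_mk' (relatorIdeal F) ξ
  have : (ofFree F a : Tet F) ∈ S := by
    rw [← hg]; exact (g a).2
  exact this

variable {F}

/-- The homomorphism from the tetrahedron algebra determined by a family of elements that satisfy
the relations. -/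
theorem exists_hom {L : Type*} [LieRing L] [LieAlgebra F L] (f : Fin 4 → Fin 4 → L)
    (hskew : ∀ i j, i ≠ j → f i j + f j i = 0)
    (htri : ∀ h i j, h ≠ i → i ≠ j → h ≠ j →
      ⁅f h i, f i j⁆ = (2 : F) • f h i + (2 : F) • f i j)
    (hdg : ∀ h i j k, h ≠ i → h ≠ j → h ≠ k → i ≠ j → i ≠ k → j ≠ k →
      ⁅f h i, ⁅f h i, ⁅f h i, f j k⁆⁆⁆ = (4 : F) • ⁅f h i, f j k⁆) :
    ∃ π : Tet F →ₗ⁅F⁆ L, ∀ i j hij, π (x F i j hij) = f i j := by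
  let φ : FreeLieAlgebra F Gen →ₗ⁅F⁆ L := FreeLieAlgebra.lift F fun p => f p.1.1 p.1.2
  have hφ : ∀ i j hij, φ (freeGen F i j hij) = f i j := fun i j hij =>
    FreeLieAlgebra.lift_of_apply _ _
  have hker : relatorIdeal F ≤ φ.ker := by
    refine LieSubmodule.lieSpan_le.mpr ?_
    rintro r (⟨i, j, hij⟩ | ⟨h, i, j, hhi, hij, hhj⟩ | ⟨h, i, j, k, hhi, hhj, hhk, hij, hik, hjk⟩)
    · simp [LieHom.mem_ker, hφ, hskew i j hij]
    · simp [LieHom.mem_ker, hφ, htri h i j hhi hij hhj]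
    · simp [LieHom.mem_ker, hφ, hdg h i j k hhi hhj hhk hij hik hjk]
  let π₀ : Tet F →ₗ[F] L := (relatorIdeal F).toSubmodule.liftQ φ.toLinearMap
    (fun r hr => hker hr)
  have hπ₀ : ∀ a, π₀ (LieSubmodule.Quotient.mk a) = φ a := fun a => rfl
  refine ⟨{ π₀ with map_lie' := ?_ }, fun i j hij => hφ i j hij⟩
  intro ξ η
  obtain ⟨a, rfl⟩ := LieSubmodule.Quotient.surjective_mk' (relatorIdeal F) ξ
  obtain ⟨c, rfl⟩ := LieSubmodule.Quotient.surjective_mk' (relatorIdeal F) η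
  exact φ.map_lie a c

variable (F)

/-- The generators `x₁₂, x₂₃, x₃₁`. -/
def inner : Fin 3 → Tet F := ![x F 1 2, x F 2 3, x F 3 1]

/-- The generators `x₀₃, x₀₁, x₀₂`. -/
def outer : Fin 3 → Tet F := ![x F 0 3, x F 0 1, x F 0 2]

theorem x_lie_x_same_target (h i j : Fin 4) (hij : i ≠ j) (hhj : h ≠ j) (hih : i ≠ h) :
    ⁅x F i j hij, x F h j hhj⁆ = (2 : F) • x F h j hhj - (2 : F) • x F i j hij := by
  rw [x_skew F h j, lie_neg, x_triangle F i j h hij hhj.symm hih]; module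

theorem x_lie_x_same_source (h i j : Fin 4) (hhi : h ≠ i) (hhj : h ≠ j) (hij : i ≠ j) :
    ⁅x F h i hhi, x F h j hhj⁆ = (2 : F) • x F h i hhi - (2 : F) • x F h j hhj := by
  rw [x_skew F h i, neg_lie, x_triangle F i h j hhi.symm hhj hij]; module

theorem x_triangle_swap (h i j : Fin 4) (hhi : h ≠ i) (hij : i ≠ j) (hhj : h ≠ j) :
    ⁅x F i j hij, x F h i hhi⁆ = (-2 : F) • x F h i hhi - (2 : F) • x F i j hij := by
  rw [← lie_skew, x_triangle F h i j hhi hij hhj]; module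

theorem tetRel : Equit.TetRel F (inner F) (outer F) where
  lie_s_s i := by fin_cases i <;> exact x_triangle F _ _ _ _ _ (by decide)
  lie_s_y i := by fin_cases i <;> exact x_lie_x_same_target F _ _ _ _ _ (by decide)
  lie_s_y' i := by fin_cases i <;> exact x_triangle_swap F _ _ _ _ _ (by decide)
  lie_y_y i := by fin_cases i <;> exact x_lie_x_same_source F _ _ _ _ _ (by decide)
  cube_s i := by
    fin_cases i
    all_goals exact x_dolanGrady F _ _ _ _ _ (by decide) (by decide) (by decide) (by decide) _
  cube_y i := by
    fin_cases i
    all_goals exact x_dolanGrady F _ _ _ _ _ (by decide) (by decide) (by decide) (by decide) _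

theorem lieSpan_inner_outer_eq_top :
    LieSubalgebra.lieSpan F (Tet F) (Set.range (inner F) ∪ Set.range (outer F)) = ⊤ := by
  rw [eq_top_iff, ← lieSpan_x_eq_top, LieSubalgebra.lieSpan_le]
  rintro _ ⟨⟨⟨i, j⟩, hij⟩, rfl⟩
  have hs : ∀ k, inner F k ∈ LieSubalgebra.lieSpan F (Tet F)
      (Set.range (inner F) ∪ Set.range (outer F)) :=
    fun k => LieSubalgebra.subset_lieSpan (Or.inl ⟨k, rfl⟩)
  have hy : ∀ k, outer F k ∈ LieSubalgebra.lieSpan F (Tet F)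
      (Set.range (inner F) ∪ Set.range (outer F)) :=
    fun k => LieSubalgebra.subset_lieSpan (Or.inr ⟨k, rfl⟩)
  have hneg : ∀ i j hij, x F j i (Ne.symm hij) ∈ LieSubalgebra.lieSpan F (Tet F)
      (Set.range (inner F) ∪ Set.range (outer F)) → x F i j hij ∈ LieSubalgebra.lieSpan F (Tet F)
      (Set.range (inner F) ∪ Set.range (outer F)) := fun i j hij h => by
    rw [x_skew]; exact neg_mem h
  fin_cases i <;> fin_cases j <;> first
    | exact absurd rfl hij
    | exact hs 0
    | exact hs 1
    | exact hs 2
    | exact hy 0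
    | exact hy 1
    | exact hy 2
    | exact hneg _ _ _ (hs 0)
    | exact hneg _ _ _ (hs 1)
    | exact hneg _ _ _ (hs 2)
    | exact hneg _ _ _ (hy 0)
    | exact hneg _ _ _ (hy 1)
    | exact hneg _ _ _ (hy 2)

variable {F}

/-- The elements whose adjoint action preserves W form a subalgebra, so stability need only be
checked on generators; W itself need not be a subalgebra. -/
theorem mem_of_mem_lieSpan {L : Type*} [LieRing L] [LieAlgebra F L] {S : Set L}
    {W : Submodule F L} (hS : S ⊆ W) (hlie : ∀ a ∈ S, ∀ w ∈ W, ⁅a, w⁆ ∈ W) {ξ : L}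
    (hξ : ξ ∈ LieSubalgebra.lieSpan F L S) : ξ ∈ W := by
  have hstab : ∀ a ∈ LieSubalgebra.lieSpan F L S, ∀ w ∈ W, ⁅a, w⁆ ∈ W := by
    intro a ha
    induction ha using LieSubalgebra.lieSpan_induction with
    | mem a ha => exact hlie a ha
    | zero => simp
    | add a c _ _ iha ihc =>
      intro w hw
      rw [add_lie]; exact add_mem (iha w hw) (ihc w hw)
    | smul r a _ iha =>
      intro w hw
      rw [smul_lie]; exact Submodule.smul_mem _ r (iha w hw)
    | lie a c _ _ iha ihc =>
      intro w hw
      rw [lie_lie]; exact sub_mem (iha _ (ihc w hw)) (ihc _ (iha w hw))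
  induction hξ using LieSubalgebra.lieSpan_induction with
  | mem a ha => exact hS ha
  | zero => exact zero_mem _
  | add a c _ _ iha ihc => exact add_mem iha ihc
  | smul r a _ iha => exact Submodule.smul_mem _ r iha
  | lie a c ha _ _ ihc => exact hstab a ha c ihc

open Equit

/-- The values `t, 1 - t⁻¹, (1 - t)⁻¹`. -/
def evalMap (t : F) : Fin 3 → F := ![t, 1 - t⁻¹, (1 - t)⁻¹]

/-- The images of `x₀₃, x₀₁, x₀₂` under evaluation at `t`. -/
def evalOuter (t : F) (i : Fin 3) : Equit F :=
  evalMap t i • b (i + 1) + (evalMap t i - 1) • b (i + 2)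

/-- The table of generators determined by the images `p` of `x₁₂, x₂₃, x₃₁` and `q` of
`x₀₃, x₀₁, x₀₂`. -/
def genTable {L : Type*} [LieRing L] (p q : Fin 3 → L) : Fin 4 → Fin 4 → L :=
  ![![0, q 1, q 2, q 0], ![-q 1, 0, p 0, -p 2], ![-q 2, -p 0, 0, p 1], ![-q 0, p 2, -p 1, 0]]

/-- The images of the generators under evaluation at `t`. -/
def evalX (t : F) : Fin 4 → Fin 4 → Equit F := genTable b (evalOuter t)

theorem evalX_skew (t : F) (i j : Fin 4) : evalX t i j + evalX t j i = 0 := by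
  fin_cases i <;> fin_cases j <;> simp [evalX, genTable]

theorem evalX_triangle {t : F} (h0 : t ≠ 0) (h1 : t ≠ 1) (h i j : Fin 4) (hhi : h ≠ i)
    (hij : i ≠ j) (hhj : h ≠ j) :
    ⁅evalX t h i, evalX t i j⁆ = (2 : F) • evalX t h i + (2 : F) • evalX t i j := by
  have h2 : 1 - t ≠ 0 := sub_ne_zero.mpr (Ne.symm h1)
  fin_cases h <;> fin_cases i <;> first | exact absurd rfl hhi | skip
  all_goals fin_cases j <;> first | exact absurd rfl hij | exact absurd rfl hhj | skip
  all_goals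
    apply ext_three <;> simp [evalX, genTable, evalOuter, evalMap, b_apply] <;> field_simp <;> ring

/-- The Dolan-Grady relation `[p, [p, [p, q]]] = 4 [p, q]`. -/
def DolanGrady {L : Type*} [LieRing L] [LieAlgebra F L] (p q : L) : Prop :=
  ⁅p, ⁅p, ⁅p, q⁆⁆⁆ = (4 : F) • ⁅p, q⁆

theorem DolanGrady.neg_left {L : Type*} [LieRing L] [LieAlgebra F L] {p q : L}
    (h : DolanGrady (F := F) p q) : DolanGrady (F := F) (-p) q := by
  simp only [DolanGrady, neg_lie, lie_neg, neg_neg, smul_neg, neg_inj] at *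
  exact h

theorem DolanGrady.neg_right {L : Type*} [LieRing L] [LieAlgebra F L] {p q : L}
    (h : DolanGrady (F := F) p q) : DolanGrady (F := F) p (-q) := by
  simp only [DolanGrady, lie_neg, smul_neg, neg_inj] at *
  exact h

theorem dolanGrady_b_evalOuter (t : F) (i : Fin 3) :
    DolanGrady (F := F) (b i : Equit F) (evalOuter t i) := by
  simp only [evalOuter, DolanGrady]
  generalize evalMap t i = a
  fin_cases i <;> apply ext_three <;> simp [b_apply] <;> ring

theorem dolanGrady_evalOuter_b (t : F) (i : Fin 3) :
    DolanGrady (F := F) (evalOuter t i) (b i : Equit F) := by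
  simp only [evalOuter, DolanGrady]
  generalize evalMap t i = a
  fin_cases i <;> apply ext_three <;> simp [b_apply] <;> ring

set_option maxHeartbeats 1000000 in
theorem dolanGrady_genTable {L : Type*} [LieRing L] [LieAlgebra F L] {p q : Fin 3 → L}
    (h1 : ∀ i, DolanGrady (F := F) (p i) (q i)) (h2 : ∀ i, DolanGrady (F := F) (q i) (p i))
    (h i j k : Fin 4) (hhi : h ≠ i) (hhj : h ≠ j) (hhk : h ≠ k) (hij : i ≠ j) (hik : i ≠ k)
    (hjk : j ≠ k) : DolanGrady (F := F) (genTable p q h i) (genTable p q j k) := by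
  fin_cases h <;> fin_cases i <;> first | exact absurd rfl hhi | skip
  all_goals fin_cases j <;> first | exact absurd rfl hij | exact absurd rfl hhj | skip
  all_goals
    fin_cases k <;> first
      | exact absurd rfl hik
      | exact absurd rfl hhk
      | exact absurd rfl hjk
      | skip
  all_goals first
    | exact h1 0
    | exact h1 1
    | exact h1 2
    | exact h2 0
    | exact h2 1
    | exact h2 2
    | exact (h1 0).neg_left
    | exact (h1 1).neg_left
    | exact (h1 2).neg_left
    | exact (h2 0).neg_left
    | exact (h2 1).neg_left
    | exact (h2 2).neg_left
    | exact (h1 0).neg_right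
    | exact (h1 1).neg_right
    | exact (h1 2).neg_right
    | exact (h2 0).neg_right
    | exact (h2 1).neg_right
    | exact (h2 2).neg_right
    | exact (h1 0).neg_left.neg_right
    | exact (h1 1).neg_left.neg_right
    | exact (h1 2).neg_left.neg_right
    | exact (h2 0).neg_left.neg_right
    | exact (h2 1).neg_left.neg_right
    | exact (h2 2).neg_left.neg_right

/-- Evaluation at `t`, as a homomorphism to `sl₂`. -/
theorem exists_evalHom {t : F} (h0 : t ≠ 0) (h1 : t ≠ 1) :
    ∃ π : Tet F →ₗ⁅F⁆ Equit F, (∀ i, π (inner F i) = b i) ∧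
      ∀ i, π (outer F i) = evalOuter t i := by
  obtain ⟨π, hπ⟩ := exists_hom (evalX t) (fun i j _ => evalX_skew t i j) (evalX_triangle h0 h1)
    (dolanGrady_genTable (dolanGrady_b_evalOuter t) (dolanGrady_evalOuter_b t))
  refine ⟨π, fun i => ?_, fun i => ?_⟩
  · fin_cases i <;> exact hπ _ _ _
  · fin_cases i <;> exact hπ _ _ _

end Tet

end TetrahedronAlgebra

/-! ### Independence by partial fractions, and evaluation of coordinate maps. -/

namespace Equit

open Polynomial

section Independence

variable {F : Type*} [Field F]

theorem reverse_eval_mul {f : F[X]} {t : F} (ht : t ≠ 0) :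
    f.reverse.eval t = f.eval t⁻¹ * t ^ f.natDegree := by
  let _ : Invertible (t⁻¹) := ⟨t, mul_inv_cancel₀ ht, inv_mul_cancel₀ ht⟩
  have := eval₂_reverse_mul_pow (RingHom.id F) t⁻¹ f
  change eval t f.reverse * t⁻¹ ^ f.natDegree = eval t⁻¹ f at this
  rw [← this, mul_assoc, ← mul_pow, inv_mul_cancel₀ ht, one_pow, mul_one]

theorem eq_zero_of_reverse_eval_zero {f : F[X]} (h : f.reverse.eval 0 = 0) : f = 0 := by
  rwa [← coeff_zero_eq_eval_zero, coeff_zero_reverse, leadingCoeff_eq_zero] at h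

variable [CharZero F]

theorem eq_zero_of_forall_eval {f : F[X]} (h : ∀ t : F, t ≠ 0 → t ≠ 1 → f.eval t = 0) :
    f = 0 := by
  refine eq_zero_of_infinite_isRoot f (Set.Infinite.mono ?_
    (Set.toFinite ({0, 1} : Set F)).infinite_compl)
  intro t ht
  simp only [Set.mem_compl_iff, Set.mem_insert_iff, Set.mem_singleton_iff, not_or] at ht
  exact h t ht.1 ht.2

/-- Partial fractions with poles at `∞`, `0` and `1`. -/
theorem partial_fractions_eq_zero {p q w : F[X]}
    (h : ∀ t : F, t ≠ 0 → t ≠ 1 → p.eval t + (1 - t⁻¹ - 1) * q.eval (1 - t⁻¹)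
      + (1 - t)⁻¹ * w.eval (1 - t)⁻¹ = 0) : p = 0 ∧ q = 0 ∧ w = 0 := by
  set q₁ := q.comp (1 - X) with hq₁
  have hq : q = q₁.comp (1 - X) := by
    rw [hq₁, comp_assoc]; simp
  set n := q₁.natDegree
  set m := w.natDegree
  -- Denominators are cleared by tⁿ⁺¹(1 - t)ᵐ⁺¹. The values at 0 and 1 then isolate the leading
  -- coefficients of `q₁` and `w`.
  have key : p * X ^ (n + 1) * (1 - X) ^ (m + 1) - q₁.reverse * (1 - X) ^ (m + 1)
      + w.reverse.comp (1 - X) * X ^ (n + 1) = 0 := by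
    refine eq_zero_of_forall_eval fun t h0 h1 => ?_
    have h2 : 1 - t ≠ 0 := sub_ne_zero.mpr (Ne.symm h1)
    have e := h t h0 h1
    have e1 : q.eval (1 - t⁻¹) = q₁.eval t⁻¹ := by rw [hq₁]; simp
    rw [e1] at e
    simp only [eval_add, eval_sub, eval_mul, eval_pow, eval_X, eval_one, eval_comp,
      reverse_eval_mul h0, reverse_eval_mul h2]
    have e2 : (p.eval t + (1 - t⁻¹ - 1) * q₁.eval t⁻¹ + (1 - t)⁻¹ * w.eval (1 - t)⁻¹)
        * (t ^ (n + 1) * (1 - t) ^ (m + 1)) = 0 := by rw [e, zero_mul]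
    rw [← e2]
    change _ - q₁.eval t⁻¹ * t ^ n * _ + w.eval (1 - t)⁻¹ * (1 - t) ^ m * _ = _
    have e3 : t⁻¹ * t = 1 := inv_mul_cancel₀ h0
    have e4 : (1 - t)⁻¹ * (1 - t) = 1 := inv_mul_cancel₀ h2
    linear_combination (q₁.eval t⁻¹ * t ^ n * (1 - t) ^ (m + 1)) * e3
      - (w.eval (1 - t)⁻¹ * (1 - t) ^ m * t ^ (n + 1)) * e4
  have hq0 : q₁ = 0 := by
    have := congrArg (eval 0) key
    simp only [eval_add, eval_sub, eval_mul, eval_pow, eval_X, eval_one, eval_zero] at this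
    exact eq_zero_of_reverse_eval_zero (by simpa using this)
  have hw0 : w = 0 := by
    have := congrArg (eval 1) key
    simp only [eval_add, eval_sub, eval_mul, eval_pow, eval_X, eval_one, eval_zero,
      eval_comp, hq0] at this
    exact eq_zero_of_reverse_eval_zero (by simpa using this)
  have hp0 : p = 0 := by
    rw [hq0, hw0] at key
    have h1 : (1 - X : F[X]) ≠ 0 := fun h => by simpa using congrArg (eval 0) h
    simpa [h1, X_ne_zero] using key
  exact ⟨hp0, by rw [hq, hq0, zero_comp], hw0⟩

end Independence

section Eval

variable {F L : Type*} [Field F] [LieRing L] [LieAlgebra F L] [CharZero F]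

/-- Equivariance spreads the scalar t from one highest weight vector to all of sl₂; multiplicativity
and perfectness extend this to powers of X. -/
theorem eval_apply {s : Fin 3 → L} {Φ : F[X] →ₗ[F] (Equit F →ₗ[F] L)} (π : L →ₗ⁅F⁆ Equit F)
    (hs : ∀ i, π (s i) = b i) (h1 : Φ 1 = lift s)
    (hmul : ∀ f g, Mul (Φ f) (Φ g) (Φ (f * g))) {i : Fin 3} {t : F}
    (ht : π (Φ X (up i)) = t • up i) (f : F[X]) (v : Equit F) :
    π (Φ f v) = f.eval t • v := by
  have hι : ∀ v, π (Φ 1 v) = v := fun v => by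
    have : (π : L →ₗ[F] Equit F) ∘ₗ Φ 1 = LinearMap.id := hom_ext fun i => by simp [h1, hs]
    exact LinearMap.congr_fun this v
  have hequiv : ∀ p q, ⁅p, π (Φ X q)⁆ = π (Φ X ⁅p, q⁆) := fun p q => by
    have := congrArg π (hmul 1 X p q)
    rwa [one_mul, LieHom.map_lie, hι] at this
  have hb : π (Φ X (b i)) = t • b i := by
    have := hequiv (down i) (up i)
    rw [ht, lie_down_up, lie_smul, lie_down_up, map_smul, map_smul, smul_comm] at this
    exact (smul_right_injective _ (by norm_num : (4 : F) ≠ 0) this).symm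
  have hd : π (Φ X (down i)) = t • down i := by
    have := hequiv (down i) (b i)
    rw [hb, lie_down_b, lie_smul, lie_down_b, map_smul, map_smul, smul_comm] at this
    exact (smul_right_injective _ (by norm_num : (2 : F) ≠ 0) this).symm
  have hX : ∀ v, π (Φ X v) = t • v := fun v => by
    rw [eq_combination i v]
    simp only [map_add, map_smul, hb, ht, hd]
    module
  induction f using induction_X_pow with
  | hadd f g hf hg => rw [map_add, LinearMap.add_apply, map_add, hf, hg, eval_add, add_smul]
  | hsmul a f hf => rw [map_smul, LinearMap.smul_apply, map_smul, hf, eval_smul, smul_smul,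
      smul_eq_mul]
  | hX n =>
    rw [eval_pow, eval_X]
    induction n generalizing v with
    | zero => rw [pow_zero, hι, pow_zero, one_smul]
    | succ n ih =>
      obtain ⟨p, q, p', q', p'', q'', rfl⟩ := exists_lie_eq i v
      have : ∀ p q : Equit F, π (Φ (X ^ (n + 1)) ⁅p, q⁆) = t ^ (n + 1) • ⁅p, q⁆ := fun p q => by
        rw [pow_succ', ← hmul X (X ^ n) p q, LieHom.map_lie, hX, ih, smul_lie, lie_smul, smul_smul,
          pow_succ']
      simp only [map_add, this, smul_add]

end Eval

end Equit

/-! ### Subspaces cut out by the support of coordinates. -/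

namespace TetrahedronAlgebra

section Support

variable {F L M ι : Type*} [Field F] [AddCommGroup L] [Module F L] [AddCommGroup M] [Module F M]

/-- The elements whose coordinates vanish outside `S`. -/
def supported (E : L ≃ₗ[F] (ι → M)) (S : Set ι) : Submodule F L where
  carrier := {ξ | ∀ i ∉ S, E ξ i = 0}
  zero_mem' := by simp
  add_mem' h h' i hi := by simp [h i hi, h' i hi]
  smul_mem' c ξ h i hi := by simp [h i hi]

theorem mem_supported {E : L ≃ₗ[F] (ι → M)} {S : Set ι} {ξ : L} :
    ξ ∈ supported E S ↔ ∀ i ∉ S, E ξ i = 0 := Iff.rfl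

theorem supported_mono (E : L ≃ₗ[F] (ι → M)) {S T : Set ι} (h : S ⊆ T) :
    supported E S ≤ supported E T := fun _ hξ i hi => hξ i fun hS => hi (h hS)

theorem supported_univ (E : L ≃ₗ[F] (ι → M)) : supported E Set.univ = ⊤ := by
  ext; simp [mem_supported]

theorem supported_inter (E : L ≃ₗ[F] (ι → M)) (S T : Set ι) :
    supported E (S ∩ T) = supported E S ⊓ supported E T := by
  ext ξ
  simp only [Submodule.mem_inf, mem_supported, Set.mem_inter_iff]
  constructor
  · exact fun h => ⟨fun i hi => h i fun h' => hi h'.1, fun i hi => h i fun h' => hi h'.2⟩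
  · intro h i hi
    by_cases hS : i ∈ S
    · exact h.2 i fun hT => hi ⟨hS, hT⟩
    · exact h.1 i hS

theorem isDirectSumOf_supported [Fintype ι] (E : L ≃ₗ[F] (ι → M)) {κ : Type*} {S : Set ι}
    (A : κ → Set ι) (hd : Pairwise fun k l => Disjoint (A k) (A l)) (hS : ⋃ k, A k = S) :
    IsDirectSumOf (supported E S) (fun k => supported E (A k)) := by
  classical
  constructor
  · rw [iSupIndep_def]
    intro k
    have hle : ⨆ l, ⨆ (_ : l ≠ k), supported E (A l) ≤ supported E (A k)ᶜ :=
      iSup₂_le fun l hl => supported_mono E fun i hi hi' => Set.disjoint_left.mp (hd hl) hi hi'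
    refine Disjoint.mono_right hle ?_
    rw [Submodule.disjoint_def]
    intro ξ h h'
    rw [← LinearEquiv.map_eq_zero_iff E]
    ext i
    by_cases hi : i ∈ A k
    · exact h' i fun hc => hc hi
    · exact h i hi
  · refine le_antisymm (iSup_le fun k => supported_mono E (hS ▸ Set.subset_iUnion A k)) ?_
    intro ξ hξ
    have : ξ = ∑ i, E.symm (Pi.single i (E ξ i)) := by
      rw [← map_sum, Finset.univ_sum_single, LinearEquiv.symm_apply_apply]
    rw [this]
    refine sum_mem fun i _ => ?_
    by_cases hi : i ∈ S
    · rw [← hS, Set.mem_iUnion] at hi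
      obtain ⟨k, hk⟩ := hi
      refine Submodule.mem_iSup_of_mem k fun j hj => ?_
      rw [LinearEquiv.apply_symm_apply, Pi.single_eq_of_ne]
      rintro rfl
      exact hj hk
    · rw [hξ i hi, Pi.single_zero, map_zero]
      exact zero_mem _

end Support

/-! ### The nine coordinates and the rows. -/

section Coordinates

open Polynomial Equit

variable (F : Type*) [Field F]

theorem row_eq (r : Fin 3) : ∃ (i j : Fin 4) (hij : i ≠ j),
    row F r = X F i j hij ∧ x F i j hij = inner F r := by
  fin_cases r
  · exact ⟨1, 2, by decide, rfl, rfl⟩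
  · exact ⟨2, 3, by decide, rfl, rfl⟩
  · exact ⟨3, 1, by decide, rfl, rfl⟩

theorem col_eq (c : Fin 3) :
    col F c = (LieSubalgebra.lieSpan F (Tet F) {inner F c, outer F c}).toSubmodule := by
  fin_cases c <;> rfl

/-- Evaluation at `t`, as a homomorphism to `sl₂`. -/
def evalHom (t : F) (h0 : t ≠ 0) (h1 : t ≠ 1) : Tet F →ₗ⁅F⁆ Equit F :=
  (exists_evalHom h0 h1).choose

theorem evalHom_inner {t : F} (h0 : t ≠ 0) (h1 : t ≠ 1) (i : Fin 3) :
    evalHom F t h0 h1 (inner F i) = b i := (exists_evalHom h0 h1).choose_spec.1 i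

theorem evalHom_outer {t : F} (h0 : t ≠ 0) (h1 : t ≠ 1) (i : Fin 3) :
    evalHom F t h0 h1 (outer F i) = evalOuter t i := (exists_evalHom h0 h1).choose_spec.2 i

variable [CharZero F]

/-- The coordinate maps of the tetrahedron algebra. -/
def coord : Fin 3 → F[X] →ₗ[F] (Equit F →ₗ[F] Tet F) := (tetRel F).exists_coordinates.choose

theorem coord_one (c : Fin 3) : coord F c 1 = lift (inner F) :=
  (tetRel F).exists_coordinates.choose_spec.1 c

theorem coord_one_b (c r : Fin 3) : coord F c 1 (b r) = inner F r := by
  rw [coord_one, lift_b]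

theorem coord_X (c : Fin 3) :
    coord F c Polynomial.X (up (c + 1)) = outer F c + inner F (c + 2) :=
  (tetRel F).exists_coordinates.choose_spec.2.1 c

theorem mul_coord (c : Fin 3) (f g : F[X]) : Mul (coord F c f) (coord F c g) (coord F c (f * g)) :=
  (tetRel F).exists_coordinates.choose_spec.2.2.1 c f g

theorem exists_mul_coord (c d : Fin 3) (f : F[X]) :
    ∃ χ ∈ ⨆ k, LinearMap.range (coord F k), Mul (coord F d Polynomial.X) (coord F c f) χ :=
  (tetRel F).exists_coordinates.choose_spec.2.2.2 c d f

theorem evalHom_coord {t : F} (h0 : t ≠ 0) (h1 : t ≠ 1) (c : Fin 3) (f : F[X]) (v : Equit F) :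
    evalHom F t h0 h1 (coord F c f v) = f.eval (evalMap t c) • v := by
  refine eval_apply (s := inner F) _ (evalHom_inner F h0 h1) (coord_one F c) (mul_coord F c)
    (i := c + 1) ?_ f v
  rw [coord_X, map_add, evalHom_inner, evalHom_outer, evalOuter, up, fin_add_one_add_one]
  module

/-- The weights of the coordinates. -/
def weight : Fin 3 → F[X] := ![1, Polynomial.X, Polynomial.X - 1]

/-- The coordinate `(r, c)`, spanning `X ∩ O` for the `r`-th `X` and the `c`-th `O`. -/
def coordMap (p : Fin 3 × Fin 3) : F[X] →ₗ[F] Tet F :=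
  ((coord F p.2).flip (b p.1)) ∘ₗ LinearMap.mulLeft F (weight F (p.1 - p.2))

theorem coordMap_apply (r c : Fin 3) (f : F[X]) :
    coordMap F (r, c) f = coord F c (weight F (r - c) * f) (b r) := rfl

/-- The sum of all coordinates. -/
def total : (Fin 3 × Fin 3 → F[X]) →ₗ[F] Tet F :=
  LinearMap.lsum F (fun _ => F[X]) F (coordMap F)

theorem total_apply (f : Fin 3 × Fin 3 → F[X]) : total F f = ∑ p, coordMap F p (f p) := by
  simp [total, LinearMap.lsum_apply]

theorem total_single (p : Fin 3 × Fin 3) (f : F[X]) :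
    total F (Pi.single p f) = coordMap F p f := by
  rw [total_apply, Finset.sum_eq_single p]
  · simp
  · intro q _ hq; simp [Pi.single_eq_of_ne hq]
  · simp

theorem evalHom_total {t : F} (h0 : t ≠ 0) (h1 : t ≠ 1) (f : Fin 3 × Fin 3 → F[X]) (r : Fin 3) :
    evalHom F t h0 h1 (total F f) r
      = ∑ c, (weight F (r - c) * f (r, c)).eval (evalMap t c) := by
  rw [total_apply, map_sum, Fintype.sum_prod_type]
  simp only [coordMap_apply, evalHom_coord]
  have hsum : ∀ (g : Fin 3 → Equit F), (∑ i, g i) r = ∑ i, g i r := fun g => by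
    simp [Fin.sum_univ_three]
  rw [hsum, Finset.sum_eq_single r]
  · rw [hsum]; simp [b_apply]
  · intro r' _ hr'
    rw [hsum]; simp [b_apply, hr'.symm]
  · simp

/-- The cyclic symmetry t ↦ 1 - t⁻¹ has order three; it reduces partial fractions for any row to the
case r = 0. -/
theorem evalMap_shift {t : F} (h0 : t ≠ 0) (h1 : t ≠ 1) (r : Fin 3) :
    ∃ u : F, u ≠ 0 ∧ u ≠ 1 ∧ evalMap u r = t ∧ evalMap u (r + 1) = 1 - t⁻¹ ∧
      evalMap u (r + 2) = (1 - t)⁻¹ := by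
  have h2 : 1 - t ≠ 0 := sub_ne_zero.mpr (Ne.symm h1)
  have h3 : t - 1 ≠ 0 := sub_ne_zero.mpr h1
  fin_cases r
  · exact ⟨t, h0, h1, rfl, rfl, rfl⟩
  · refine ⟨(1 - t)⁻¹, inv_ne_zero h2, ?_, ?_, ?_, ?_⟩
    · intro h; rw [inv_eq_one] at h; exact h0 (by linear_combination -h)
    · simp [evalMap]
    · have : 1 - (1 - t)⁻¹ = -t / (1 - t) := by field_simp; ring
      simp only [evalMap]
      change (1 - (1 - t)⁻¹)⁻¹ = 1 - t⁻¹
      rw [this]; field_simp; ring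
    · rfl
  · refine ⟨1 - t⁻¹, ?_, ?_, ?_, ?_, ?_⟩
    · intro h; apply h1; field_simp at h; linear_combination h
    · intro h; apply inv_ne_zero h0; linear_combination -h
    · change (1 - (1 - t⁻¹))⁻¹ = t
      simp
    · rfl
    · change 1 - (1 - t⁻¹)⁻¹ = (1 - t)⁻¹
      have : 1 - t⁻¹ = (t - 1) / t := by field_simp
      rw [this]; field_simp; ring

theorem fin_sub_add_one (r : Fin 3) : r - (r + 1) = 2 := by revert r; decide
theorem fin_sub_add_two (r : Fin 3) : r - (r + 2) = 1 := by revert r; decide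

theorem eq_zero_of_evalHom_apply {f : Fin 3 × Fin 3 → F[X]} {r : Fin 3}
    (h : ∀ t h0 h1, evalHom F t h0 h1 (total F f) r = 0) (c : Fin 3) : f (r, c) = 0 := by
  have key := partial_fractions_eq_zero (p := f (r, r)) (q := f (r, r + 1)) (w := f (r, r + 2)) ?_
  · obtain rfl | rfl | rfl := fin_cases_add r c
    exacts [key.1, key.2.1, key.2.2]
  · intro t h0 h1
    obtain ⟨u, hu0, hu1, e0, e1, e2⟩ := evalMap_shift F h0 h1 r
    have := h u hu0 hu1
    have hsum : ∀ g : Fin 3 → F, ∑ i, g i = g r + g (r + 1) + g (r + 2) := fun g => by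
      rw [Fin.sum_univ_three]
      fin_cases r
      · rfl
      · change _ = g 1 + g 2 + g 0; ring
      · change _ = g 2 + g 0 + g 1; ring
    rw [evalHom_total, hsum, e0, e1, e2, sub_self, fin_sub_add_one,
      fin_sub_add_two] at this
    simpa [weight] using this

theorem total_injective : Function.Injective (total F) := by
  rw [← LinearMap.ker_eq_bot, LinearMap.ker_eq_bot']
  intro f hf
  ext1 ⟨r, c⟩
  exact eq_zero_of_evalHom_apply F (fun t h0 h1 => by rw [hf]; simp) c

/-- Subtracting a constant makes f divisible by the weight 1, X or X - 1. The constant itself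
belongs to the coordinate (r, r), since constants give the same element for every c. -/
theorem coord_b_mem_range (c r : Fin 3) (f : F[X]) :
    coord F c f (b r) ∈ LinearMap.range (total F) := by
  have hmem : ∀ p g, coordMap F p g ∈ LinearMap.range (total F) := fun p g =>
    ⟨Pi.single p g, total_single F p g⟩
  have hC : ∀ a : F, coord F c (C a) (b r) ∈ LinearMap.range (total F) := fun a => by
    have := hmem (r, r) (C a)
    rwa [coordMap_apply, sub_self, show weight F 0 = 1 from rfl, one_mul, ← mul_one (C a),
      ← smul_eq_C_mul, map_smul, coord_one, ← coord_one F c, ← map_smul, smul_eq_C_mul,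
      mul_one] at this
  have hdvd : ∀ g a, weight F (r - c) * g = f - C a →
      coord F c f (b r) ∈ LinearMap.range (total F) := fun g a e => by
    have := add_mem (hmem (r, c) g) (hC a)
    rwa [coordMap_apply, ← LinearMap.add_apply, ← map_add, e, sub_add_cancel] at this
  obtain rfl | rfl | rfl := fin_cases_add c r
  · refine hdvd f 0 ?_
    rw [sub_self, show weight F 0 = 1 from rfl]; simp
  · obtain ⟨g, hg⟩ := X_dvd_sub_C (p := f)
    refine hdvd g (f.coeff 0) ?_
    rw [add_sub_cancel_left, hg]; rfl
  · obtain ⟨g, hg⟩ := X_sub_C_dvd_sub_C_eval (a := 1) (p := f)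
    refine hdvd g (f.eval 1) ?_
    rw [add_sub_cancel_left, hg, C_1]; rfl

theorem coord_mem_range (c : Fin 3) (f : F[X]) (v : Equit F) :
    coord F c f v ∈ LinearMap.range (total F) := by
  rw [eq_sum_b v, map_sum]
  refine sum_mem fun i _ => ?_
  rw [map_smul]
  exact Submodule.smul_mem _ _ (coord_b_mem_range F c i f)

/-- The span of the values of the coordinate maps contains the generators and is stable under them,
because each t_d times a polynomial in t_c is a sum of polynomials in t₀, t₁, t₂. -/
theorem total_surjective : Function.Surjective (total F) := by
  rw [← LinearMap.range_eq_top, eq_top_iff]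
  set W : Submodule F (Tet F) := Submodule.span F {ξ | ∃ c f v, coord F c f v = ξ} with hW
  have hsub : W ≤ LinearMap.range (total F) := by
    rw [Submodule.span_le]
    rintro _ ⟨c, f, v, rfl⟩
    exact coord_mem_range F c f v
  have hmem : ∀ c f v, coord F c f v ∈ W := fun c f v => Submodule.subset_span ⟨c, f, v, rfl⟩
  have hχ : ∀ χ ∈ ⨆ k, LinearMap.range (coord F k), ∀ v, χ v ∈ W := fun χ hχ v => by
    have : ⨆ k, LinearMap.range (coord F k) ≤ W.comap (LinearMap.applyₗ v) := by
      refine iSup_le fun k => ?_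
      rintro _ ⟨f, rfl⟩
      exact hmem k f v
    exact this hχ
  have hs : ∀ r, inner F r ∈ W := fun r => coord_one_b F 0 r ▸ hmem 0 1 (b r)
  have hy : ∀ c, outer F c = coord F c Polynomial.X (up (c + 1)) - inner F (c + 2) := fun c => by
    rw [coord_X]; abel
  have hgen : ∀ a : Tet F, (∀ c f v, ⁅a, coord F c f v⁆ ∈ W) → ∀ w ∈ W, ⁅a, w⁆ ∈ W := by
    intro a h w hw
    have : W ≤ W.comap (LieModule.toEnd F (Tet F) (Tet F) a) := by
      rw [hW, Submodule.span_le]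
      rintro _ ⟨c, f, v, rfl⟩
      exact h c f v
    exact this hw
  have hinner : ∀ r c f v, ⁅inner F r, coord F c f v⁆ ∈ W := fun r c f v => by
    rw [← coord_one_b F c r, mul_coord]
    exact hmem _ _ _
  intro ξ _
  refine hsub (mem_of_mem_lieSpan (S := Set.range (inner F) ∪ Set.range (outer F)) ?_ ?_
    (by rw [lieSpan_inner_outer_eq_top]; trivial))
  · rintro _ (⟨r, rfl⟩ | ⟨c, rfl⟩)
    · exact hs r
    · rw [hy]
      exact sub_mem (hmem _ _ _) (hs _)
  · rintro _ (⟨r, rfl⟩ | ⟨d, rfl⟩)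
    · exact hgen _ (hinner r)
    · refine hgen _ fun c f v => ?_
      rw [hy, sub_lie]
      obtain ⟨χ, h, hm⟩ := exists_mul_coord F c d f
      rw [hm]
      exact sub_mem (hχ χ h _) (hinner _ _ _ _)

/-- The coordinates of the tetrahedron algebra. -/
def coordEquiv : Tet F ≃ₗ[F] (Fin 3 × Fin 3 → F[X]) :=
  (LinearEquiv.ofBijective (total F) ⟨total_injective F, total_surjective F⟩).symm

theorem total_coordEquiv (ξ : Tet F) : total F (coordEquiv F ξ) = ξ :=
  LinearEquiv.apply_symm_apply (LinearEquiv.ofBijective (total F) _) ξ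

theorem coordEquiv_coordMap (p : Fin 3 × Fin 3) (f : F[X]) :
    coordEquiv F (coordMap F p f) = Pi.single p f := by
  rw [← total_single]
  exact LinearEquiv.symm_apply_apply (LinearEquiv.ofBijective (total F) _) _

theorem eq_of_evalHom {ξ η : Tet F} (h : ∀ t h0 h1, evalHom F t h0 h1 ξ = evalHom F t h0 h1 η) :
    ξ = η := by
  rw [← sub_eq_zero, ← LinearEquiv.map_eq_zero_iff (coordEquiv F)]
  ext1 ⟨r, c⟩
  refine eq_zero_of_evalHom_apply F (fun t h0 h1 => ?_) c
  rw [total_coordEquiv, map_sub, h t h0 h1, sub_self, Equit.zero_apply]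

/-- The centralizer of `b r` in sl₂ is its span, so commuting with `inner F r` already forces the
support. Conversely, every evaluation of a supported element is a multiple of `b r` and inherits the
Dolan-Grady relation from that of the generator. -/
theorem row_eq_supported (r : Fin 3) : row F r = supported (coordEquiv F) {p | p.1 = r} := by
  obtain ⟨i, j, hij, hr, hx⟩ := row_eq F r
  rw [hr]
  refine le_antisymm ?_ ?_
  · intro ξ hξ p hp
    obtain ⟨r', c⟩ := p
    refine eq_zero_of_evalHom_apply F (fun t h0 h1 => ?_) c
    rw [total_coordEquiv]
    have h := congrArg (evalHom F t h0 h1) hξ.1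
    rw [hx, LieHom.map_lie, evalHom_inner, map_zero] at h
    generalize evalHom F t h0 h1 ξ = v at h ⊢
    have hp' : r' ≠ r := hp
    have e0 := congrFun h 0
    have e1 := congrFun h 1
    have e2 := congrFun h 2
    change ⁅b r, v⁆ 0 = 0 at e0
    change ⁅b r, v⁆ 1 = 0 at e1
    change ⁅b r, v⁆ 2 = 0 at e2
    fin_cases r <;> fin_cases r' <;> first | exact absurd rfl hp' | skip
    all_goals simp_all [b_apply]
  · intro ξ hξ
    have hev : ∀ t h0 h1, ∃ a : F, evalHom F t h0 h1 ξ = a • b r := fun t h0 h1 => by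
      rw [← total_coordEquiv F ξ]
      refine ⟨evalHom F t h0 h1 (total F (coordEquiv F ξ)) r, ?_⟩
      ext r'
      by_cases h : r' = r
      · subst h; simp [b_apply]
      · rw [evalHom_total]
        simp [b_apply, h, hξ (r', _) h]
    refine ⟨?_, fun h k hhk hhi hhj hki hkj => ?_⟩
    · refine eq_of_evalHom F fun t h0 h1 => ?_
      obtain ⟨a, ha⟩ := hev t h0 h1
      rw [hx, LieHom.map_lie, ha, evalHom_inner, lie_smul, lie_self, smul_zero, map_zero]
    · refine eq_of_evalHom F fun t h0 h1 => ?_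
      obtain ⟨a, ha⟩ := hev t h0 h1
      have := congrArg (evalHom F t h0 h1)
        (x_dolanGrady F h k i j hhk hhi hhj hki hkj hij)
      simp only [hx, LieHom.map_lie, map_smul, evalHom_inner] at this
      simp only [LieHom.map_lie, map_smul, ha, lie_smul, this]
      rw [smul_comm]

end Coordinates

/-! ### The Onsager subalgebras as columns. -/

section Columns

open Polynomial Equit

variable (F : Type*) [Field F] [CharZero F]

theorem outer_eq (c : Fin 3) : outer F c = coord F c Polynomial.X (b (c + 1))
    + coord F c (Polynomial.X - 1) (b (c + 2)) := by
  have := coord_X F c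
  rw [up, fin_add_one_add_one, map_add] at this
  rw [map_sub, LinearMap.sub_apply, coord_one_b, eq_sub_of_add_eq this.symm]
  abel

theorem coordMap_self (c : Fin 3) (f : F[X]) : coordMap F (c, c) f = coord F c f (b c) := by
  rw [coordMap_apply, sub_self, show weight F 0 = 1 from rfl, one_mul]

theorem coordMap_add_one (c : Fin 3) (f : F[X]) :
    coordMap F (c + 1, c) f = coord F c (Polynomial.X * f) (b (c + 1)) := by
  rw [coordMap_apply, add_sub_cancel_left]; rfl

theorem coordMap_add_two (c : Fin 3) (f : F[X]) :
    coordMap F (c + 2, c) f = coord F c ((Polynomial.X - 1) * f) (b (c + 2)) := by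
  rw [coordMap_apply, add_sub_cancel_left]; rfl

theorem coordMap_mem_supported (c r : Fin 3) (f : F[X]) :
    coordMap F (r, c) f ∈ supported (coordEquiv F) {p | p.2 = c} := by
  intro p hp
  rw [coordEquiv_coordMap, Pi.single_eq_of_ne]
  rintro rfl
  exact hp rfl

/-- The weights 1, X, X - 1 are such that the column is stable under both generators of the Onsager
subalgebra. -/
theorem col_le_supported (c : Fin 3) :
    col F c ≤ supported (coordEquiv F) {p | p.2 = c} := by
  set W := supported (coordEquiv F) {p : Fin 3 × Fin 3 | p.2 = c} with hW
  have h0 : ∀ f, coord F c f (b c) ∈ W := fun f =>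
    coordMap_self F c f ▸ coordMap_mem_supported F c c f
  have h1 : ∀ f, coord F c (Polynomial.X * f) (b (c + 1)) ∈ W := fun f =>
    coordMap_add_one F c f ▸ coordMap_mem_supported F c (c + 1) f
  have h2 : ∀ f, coord F c ((Polynomial.X - 1) * f) (b (c + 2)) ∈ W := fun f =>
    coordMap_add_two F c f ▸ coordMap_mem_supported F c (c + 2) f
  have hs : inner F c = coord F c 1 (b c) := (coord_one_b F c c).symm
  have hgen : ∀ a : Tet F, (∀ f, ⁅a, coord F c f (b c)⁆ ∈ W) →
      (∀ f, ⁅a, coord F c (Polynomial.X * f) (b (c + 1))⁆ ∈ W) →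
      (∀ f, ⁅a, coord F c ((Polynomial.X - 1) * f) (b (c + 2))⁆ ∈ W) →
      ∀ w ∈ W, ⁅a, w⁆ ∈ W := by
    intro a a0 a1 a2 w hw
    rw [← total_coordEquiv F w, total_apply, lie_sum]
    refine sum_mem fun p _ => ?_
    obtain ⟨r, d⟩ := p
    by_cases hd : d = c
    · subst hd
      obtain rfl | rfl | rfl := fin_cases_add d r
      · rw [coordMap_self]; exact a0 _
      · rw [coordMap_add_one]; exact a1 _
      · rw [coordMap_add_two]; exact a2 _
    · rw [hw (r, d) hd, map_zero, lie_zero]; exact zero_mem _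
  rw [col_eq]
  intro ξ hξ
  refine mem_of_mem_lieSpan ?_ ?_ hξ
  · rintro _ (rfl | rfl)
    · rw [hs]; exact h0 1
    · rw [outer_eq]
      have e1 := h1 1
      have e2 := h2 1
      rw [mul_one] at e1 e2
      exact add_mem e1 e2
  · rintro _ (rfl | rfl)
    · rw [hs]
      refine hgen _ (fun f => ?_) (fun f => ?_) fun f => ?_
      · rw [mul_coord, lie_self, map_zero]; exact zero_mem _
      · rw [mul_coord, lie_b_b_succ, map_add, map_smul, map_smul, one_mul]
        exact add_mem (W.smul_mem _ (h0 _)) (W.smul_mem _ (h1 _))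
      · rw [mul_coord, lie_b_b_add_two, map_add, map_smul, map_smul, one_mul]
        exact add_mem (W.smul_mem _ (h0 _)) (W.smul_mem _ (h2 _))
    · rw [outer_eq]
      refine hgen _ (fun f => ?_) (fun f => ?_) fun f => ?_
      · rw [add_lie, mul_coord, mul_coord, lie_b_succ_b, lie_b_add_two_b, map_add, map_add,
          map_smul, map_smul, map_smul, map_smul]
        exact add_mem (add_mem (W.smul_mem _ (h0 _)) (W.smul_mem _ (h1 _)))
          (add_mem (W.smul_mem _ (h0 _)) (W.smul_mem _ (h2 _)))
      · rw [add_lie, mul_coord, mul_coord, lie_self, map_zero, zero_add, lie_b_add_two_b_succ,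
          map_add, map_smul, map_smul]
        refine add_mem (W.smul_mem _ ?_) (W.smul_mem _ (h2 _))
        rw [mul_left_comm]; exact h1 _
      · rw [add_lie, mul_coord, mul_coord, lie_self, map_zero, add_zero, lie_b_succ_b_add_two,
          map_add, map_smul, map_smul]
        refine add_mem (W.smul_mem _ (h1 _)) (W.smul_mem _ ?_)
        rw [mul_left_comm]; exact h2 _

theorem coordMap_mem_col (c r : Fin 3) (f : F[X]) : coordMap F (r, c) f ∈ col F c := by
  rw [col_eq]
  set O := LieSubalgebra.lieSpan F (Tet F) {inner F c, outer F c}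
  change _ ∈ O
  have hsmul : ∀ {a : F} {v : Tet F}, a ≠ 0 → a • v ∈ O → v ∈ O := fun {a v} ha h => by
    have := O.smul_mem a⁻¹ h
    rwa [smul_smul, inv_mul_cancel₀ ha, one_smul] at this
  have h2 : (2 : F) ≠ 0 := two_ne_zero
  have hs : coord F c 1 (b c) ∈ O := by
    rw [coord_one_b]; exact LieSubalgebra.subset_lieSpan (by simp)
  have hy : coord F c Polynomial.X (b (c + 1)) + coord F c (Polynomial.X - 1) (b (c + 2)) ∈ O := by
    rw [← outer_eq]; exact LieSubalgebra.subset_lieSpan (by simp)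
  have hsy := O.lie_mem hs hy
  rw [lie_add, mul_coord, mul_coord, lie_b_b_succ, lie_b_b_add_two, one_mul, one_mul] at hsy
  -- Writing the outer generator as y = A + B, one has [s, y] = 2s + 2A - 2B, so [s, y] - 2s + 2y =
  -- 4A.
  have hA : coord F c Polynomial.X (b (c + 1)) ∈ O := by
    refine hsmul (by norm_num : (4 : F) ≠ 0) ?_
    have := add_mem (sub_mem hsy (O.smul_mem (2 : F) hs)) (O.smul_mem (2 : F) hy)
    convert this using 1
    simp only [map_add, map_smul, map_sub, LinearMap.sub_apply]
    module
  have hB : coord F c (Polynomial.X - 1) (b (c + 2)) ∈ O := by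
    have := sub_mem hy hA
    rwa [add_sub_cancel_left] at this
  have hpow : ∀ n : ℕ, coord F c (Polynomial.X ^ n) (b c) ∈ O ∧
      coord F c (Polynomial.X * Polynomial.X ^ n) (b (c + 1)) ∈ O ∧
      coord F c ((Polynomial.X - 1) * Polynomial.X ^ n) (b (c + 2)) ∈ O := by
    intro n
    induction n with
    | zero => simpa only [pow_zero, mul_one] using ⟨hs, hA, hB⟩
    | succ n ih =>
      obtain ⟨-, i1, -⟩ := ih
      rw [← pow_succ'] at i1
      set g : F[X] := Polynomial.X ^ (n + 1)
      have i0 : coord F c g (b c) ∈ O := by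
        have := O.lie_mem hs i1
        rw [mul_coord, lie_b_b_succ, map_add, map_smul, map_smul, one_mul] at this
        refine hsmul h2 ?_
        have := sub_mem this (O.smul_mem (2 : F) i1)
        rwa [add_sub_cancel_right] at this
      have j1 := O.lie_mem i0 hA
      have j2 := O.lie_mem i1 hB
      have j3 := O.lie_mem i0 hB
      rw [mul_coord, lie_b_b_succ, mul_comm g] at j1
      rw [mul_coord, lie_b_succ_b_add_two, mul_comm g] at j2
      rw [mul_coord, lie_b_b_add_two, mul_comm g] at j3
      -- In `j1 + j2 + j3` the terms in `b (c + 2)` cancel, and those in X g `b c` do too. Adding `2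
      -- • (i1 - i0)` leaves four times the target.
      have k1 : coord F c (Polynomial.X * g) (b (c + 1)) ∈ O := by
        refine hsmul (by norm_num : (4 : F) ≠ 0) ?_
        have := add_mem (add_mem (add_mem j1 j2) j3)
          (O.smul_mem (2 : F) (sub_mem i1 i0))
        convert this using 1
        simp only [map_add, map_smul, map_sub, LinearMap.sub_apply, sub_mul, one_mul]
        module
      have k0 : coord F c (Polynomial.X * g) (b c) ∈ O := by
        refine hsmul h2 ?_
        have := sub_mem j1 (O.smul_mem (2 : F) k1)
        rwa [map_add, map_smul, map_smul, add_sub_cancel_right] at this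
      refine ⟨i0, k1, hsmul h2 ?_⟩
      have := sub_mem j2 (O.smul_mem (2 : F) (sub_mem k1 i1))
      convert this using 1
      simp only [map_add, map_smul, map_sub, LinearMap.sub_apply, sub_mul, one_mul]
      module
  induction f using induction_X_pow with
  | hadd f g hf hg => rw [map_add]; exact add_mem hf hg
  | hsmul a f hf => rw [map_smul]; exact O.smul_mem a hf
  | hX n =>
    obtain rfl | rfl | rfl := fin_cases_add c r
    · rw [coordMap_self]; exact (hpow n).1
    · rw [coordMap_add_one]; exact (hpow n).2.1
    · rw [coordMap_add_two]; exact (hpow n).2.2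

theorem col_eq_supported (c : Fin 3) : col F c = supported (coordEquiv F) {p | p.2 = c} := by
  refine le_antisymm (col_le_supported F c) fun ξ hξ => ?_
  rw [← total_coordEquiv F ξ, total_apply]
  refine sum_mem fun p _ => ?_
  by_cases hp : p.2 = c
  · rw [← hp]; exact coordMap_mem_col F p.2 p.1 _
  · rw [hξ p hp, map_zero]; exact zero_mem _

end Columns

end TetrahedronAlgebra

end

/-! ### The decompositions as partitions of the 3 × 3 index grid. -/

theorem mainTheorem5 (F : Type*) [Field F] [CharZero F] :
    (∀ c : Fin 3, TetrahedronAlgebra.IsDirectSumOf (TetrahedronAlgebra.col F c)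
      (fun r : Fin 3 => TetrahedronAlgebra.row F r ⊓ TetrahedronAlgebra.col F c)) ∧
    (∀ r : Fin 3, TetrahedronAlgebra.IsDirectSumOf (TetrahedronAlgebra.row F r)
      (fun c : Fin 3 => TetrahedronAlgebra.row F r ⊓ TetrahedronAlgebra.col F c)) ∧
    TetrahedronAlgebra.IsDirectSumOf (⊤ : Submodule F (TetrahedronAlgebra.Tet F))
      (fun p : Fin 3 × Fin 3 =>
        TetrahedronAlgebra.row F p.1 ⊓ TetrahedronAlgebra.col F p.2) := by
  simp only [TetrahedronAlgebra.row_eq_supported, TetrahedronAlgebra.col_eq_supported,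
    ← TetrahedronAlgebra.supported_inter]
  refine ⟨fun c => ?_, fun r => ?_, ?_⟩
  · refine TetrahedronAlgebra.isDirectSumOf_supported _ _ (fun k l hkl => ?_) ?_
    · exact Set.disjoint_left.mpr fun p hp hp' => hkl (hp.1.symm.trans hp'.1)
    · ext p; simp
  · refine TetrahedronAlgebra.isDirectSumOf_supported _ _ (fun k l hkl => ?_) ?_
    · exact Set.disjoint_left.mpr fun p hp hp' => hkl (hp.2.symm.trans hp'.2)
    · ext p; simp
  · rw [← TetrahedronAlgebra.supported_univ (TetrahedronAlgebra.coordEquiv F)]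
    refine TetrahedronAlgebra.isDirectSumOf_supported _ _ (fun k l hkl => ?_) ?_
    · exact Set.disjoint_left.mpr fun p hp hp' =>
        hkl (Prod.ext (hp.1.symm.trans hp'.1) (hp.2.symm.trans hp'.2))
    · ext p; simp
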